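/- Let $V$ be a vertex operator algebra over $\mathbb{C}$ (a vertex algebra with a conformal vector $\omega$, graded by integral $L(0)$-weights, $V=\bigoplus_{n\in\mathbb{Z}}V_{(n)}$, with $\dim V_{(n)}<\infty$ and $V_{(n)}=0$ for $n$ sufficiently negative), and write $Y(u,x)=\sum_{n\in\mathbb{Z}}u_n x^{-n-1}$. Let $r$ be a positive integer and let $h\in V_{(1)}$ be such that $[h_m,h_n]=0$ for all integers $m,n\ge 0$, and such that $h_0$ is locally finite on $V$ with all its eigenvalues in $\frac1r\mathbb{Z}$. Let $R=\mathbb{C}((z^{1/r}))[\log z]$, where $\log z$ is a formal variable, and let $\partial$ be the $\mathbb{C}$-linear derivation of $R$ with $\partial=\frac{d}{dz}$ on $\mathbb{C}((z^{1/r}))$ and $\partial\log z=z^{-1}$. Set $$\Delta(h,z)=\exp(h_0\log z)\,\exp\Big(\sum_{n\ge 1}\frac{(-1)^{n-1}}{n}h_n z^{-n}\Big),$$ where for $v\in V$ $$\exp(h_0\log z)v=z^{h_0^{ss}}\exp(h_0^{n}\log z)\,v,$$ $h_0=h_0^{ss}+h_0^{n}$ being the decomposition into commuting semisimple and nilpotent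 parts on any finite-dimensional $h_0$-stable subspace containing $v$, and $z^{h_0^{ss}}$ acting as $z^{\alpha}$ on the eigenspace of $h_0^{ss}$ of eigenvalue $\alpha$; all operators are extended $R$-linearly to $V\otimes R$. Then $\Delta(h,z)$ is an $R$-valued pseudo-endomorphism of $V$: it is a linear map $\Delta: V\to V\otimes_{\mathbb{C}} R$ such that $\Delta(\mathbf 1)=\mathbf 1\otimes 1$ and $$\Delta\, Y(v,x)=Y\big(e^{x(1\otimes\partial)}\Delta(v),x\big)\,\Delta\qquad\text{for all }v\in V,$$ where $Y(u\otimes a,x)(w\otimes b)=Y(u,x)w\otimes ab$ for $u,w\in V$ and $a,b\in R$. -/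

import Mathlib

open scoped TensorProduct VertexOperator

noncomputable section

/-! ### Vertex algebras and vertex operator algebras over `ℂ` -/

/-- A vertex algebra structure on the complex vector space `V`. The state-field map is
`Y(u, x) = ∑ u_n x^{-n-1}`, each `Y(u, x)` being a linear map from `V` to `V((x))` and `u_n` being
written `(Y u)[[n]]`. The Jacobi identity is stated by comparing the coefficients of all
monomials in the three formal variables (Borcherds' identity). All sums in it are finite. -/
structure VertexAlgebra (V : Type*) [AddCommGroup V] [Module ℂ V] where
  /-- the state-field correspondence -/
  Y : V →ₗ[ℂ] VertexOperator ℂ V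
  /-- the vacuum vector -/
  vacuum : V
  /-- `Y(𝟏, x) = 1` -/
  vacuum_mode : ∀ (n : ℤ) (v : V), ((Y vacuum)[[n]]) v = if n = -1 then v else 0
  /-- `Y(u, x) 𝟏` has no singular part -/
  creation_regular : ∀ (u : V) (n : ℕ), ((Y u)[[(n : ℤ)]]) vacuum = 0
  /-- the constant term of `Y(u, x) 𝟏` is `u` -/
  creation : ∀ u : V, ((Y u)[[-1]]) vacuum = u
  /-- the Jacobi identity -/
  jacobi : ∀ (u v w : V) (l m n : ℤ),
    (∑ᶠ i : ℕ, Ring.choose m i •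
        ((Y (((Y u)[[l + (i : ℤ)]]) v))[[m + n - (i : ℤ)]]) w) =
      (∑ᶠ i : ℕ, ((-1 : ℤ) ^ i * Ring.choose l i) •
        ((Y u)[[m + l - (i : ℤ)]]) (((Y v)[[n + (i : ℤ)]]) w)) -
      (∑ᶠ i : ℕ, ((Int.negOnePow l : ℤ) * (-1 : ℤ) ^ i * Ring.choose l i) •
        ((Y v)[[n + l - (i : ℤ)]]) (((Y u)[[m + (i : ℤ)]]) w))

/-- The mode `u_n`, i.e. the coefficient of `x^{-n-1}` in `Y(u, x)`. -/
def VertexAlgebra.mode {V : Type*} [AddCommGroup V] [Module ℂ V] (A : VertexAlgebra V)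
    (u : V) (n : ℤ) : Module.End ℂ V :=
  (A.Y u)[[n]]

/-- A vertex operator algebra: a vertex algebra with a conformal vector `ω` such that, for
`L(n) = ω_{n+1}`, the Virasoro relations and `Y(L(-1)v, x) = d/dx Y(v, x)` hold, and such that
`V` is the direct sum of the eigenspaces `V_(n)` of `L(0)` for `n ∈ ℤ`, which are all finite
dimensional and vanish for `n` sufficiently negative. -/
structure VertexOperatorAlgebra (V : Type*) [AddCommGroup V] [Module ℂ V] extends
    VertexAlgebra V where
  /-- the conformal vector -/
  conformal : V
  /-- the central charge -/
  centralCharge : ℂ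
  /-- the Virasoro relations -/
  virasoro : ∀ m n : ℤ,
    ⁅(Y conformal)[[m + 1]], (Y conformal)[[n + 1]]⁆ =
      ((m : ℂ) - (n : ℂ)) • ((Y conformal)[[m + n + 1]]) +
        (if m + n = 0 then (((m : ℂ) ^ 3 - (m : ℂ)) / 12 * centralCharge) else 0) •
          (1 : Module.End ℂ V)
  /-- `Y(L(-1)v, x) = d/dx Y(v, x)` -/
  translation : ∀ (v : V) (n : ℤ),
    ((Y (((Y conformal)[[0]]) v))[[n]]) = (-(n : ℂ)) • ((Y v)[[n - 1]])
  /-- `V` is the direct sum of the eigenspaces of `L(0)` with integral eigenvalues -/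
  grading : DirectSum.IsInternal
    fun n : ℤ => Module.End.eigenspace ((Y conformal)[[1]]) (n : ℂ)
  /-- the homogeneous subspaces are finite dimensional -/
  finite_weight : ∀ n : ℤ,
    FiniteDimensional ℂ (Module.End.eigenspace ((Y conformal)[[1]]) (n : ℂ))
  /-- the grading is truncated from below -/
  truncated : ∃ N : ℤ, ∀ n < N, Module.End.eigenspace ((Y conformal)[[1]]) (n : ℂ) = ⊥

/-- The homogeneous subspace `V_(n)`, the eigenspace of `L(0)` of eigenvalue `n`. -/
def VertexOperatorAlgebra.weight {V : Type*} [AddCommGroup V] [Module ℂ V]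
    (A : VertexOperatorAlgebra V) (n : ℤ) : Submodule ℂ V :=
  Module.End.eigenspace (A.mode A.conformal 1) (n : ℂ)

/-! ### Pseudo-endomorphisms -/

section Pseudo

variable {V : Type*} [AddCommGroup V] [Module ℂ V] {R : Type*} [CommRing R] [Algebra ℂ R]

/-- The coefficient of `x^{-n-1}` in `Y(e^{x(1 ⊗ ∂)} a, x) b`, for `a, b ∈ V ⊗ R` and a derivation
`∂` of `R`, where `Y(u ⊗ f, x)(v ⊗ g) = Y(u, x)v ⊗ f g`. Thus for `a = u ⊗ f` and `b = v ⊗ g` it is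
`∑_{i ≥ 0} u_{n+i} v ⊗ (∂^i f / i!) g`, a finite sum. -/
def VertexAlgebra.tensorMode (A : VertexAlgebra V) (D : Derivation ℂ R R) (n : ℤ)
    (a b : V ⊗[ℂ] R) : V ⊗[ℂ] R :=
  ∑ᶠ i : ℕ, (i.factorial : ℂ)⁻¹ •
    TensorProduct.map₂ ((LinearMap.proj (n + (i : ℤ)) ∘ₗ VertexOperator.ncoeff) ∘ₗ A.Y)
      (LinearMap.mul ℂ R ∘ₗ (D : R →ₗ[ℂ] R) ^ i) a b

theorem VertexAlgebra.tensorMode_finite (A : VertexAlgebra V) (D : Derivation ℂ R R) (n : ℤ)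
    (a b : V ⊗[ℂ] R) :
    (Function.support fun i : ℕ => (i.factorial : ℂ)⁻¹ •
      TensorProduct.map₂ ((LinearMap.proj (n + (i : ℤ)) ∘ₗ VertexOperator.ncoeff) ∘ₗ A.Y)
        (LinearMap.mul ℂ R ∘ₗ (D : R →ₗ[ℂ] R) ^ i) a b).Finite := by
  induction a with
  | zero => simp
  | add x y hx hy =>
    refine (hx.union hy).subset fun i hi => ?_
    by_contra h
    simp only [Set.mem_union, Function.mem_support, not_or, not_not] at h
    exact hi (by simp only [map_add, LinearMap.add_apply, smul_add, h.1, h.2, add_zero])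
  | tmul u f =>
    induction b with
    | zero => simp
    | add x y hx hy =>
      refine (hx.union hy).subset fun i hi => ?_
      by_contra h
      simp only [Set.mem_union, Function.mem_support, not_or, not_not] at h
      exact hi (by simp only [map_add, smul_add, h.1, h.2, add_zero])
    | tmul v g =>
      refine (Set.finite_lt_nat
        (n.natAbs + 1 + (HahnSeries.order ((HahnModule.of ℂ).symm (A.Y u v))).natAbs)).subset
          fun i hi => ?_
      by_contra hlt
      refine hi ?_
      have h : ((A.Y u)[[n + (i : ℤ)]]) v = 0 := by
        refine VertexOperator.ncoeff_eq_zero_of_lt_order _ _ _ ?_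
        simp only [Set.mem_ofPred_eq] at hlt
        omega
      change (i.factorial : ℂ)⁻¹ • ((((A.Y u)[[n + (i : ℤ)]]) v) ⊗ₜ[ℂ] (((D : R →ₗ[ℂ] R) ^ i) f * g)) = 0
      rw [h, TensorProduct.zero_tmul, smul_zero]

/-- An `R`-valued pseudo-endomorphism of the vertex algebra `V`, for a commutative algebra `R` with
a derivation `∂`: a linear map `Δ : V → V ⊗ R` such that `Δ(𝟏) = 𝟏 ⊗ 1` and
`Δ Y(v, x) = Y(e^{x(1 ⊗ ∂)} Δ(v), x) Δ` for all `v ∈ V`. -/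
structure VertexAlgebra.IsPseudoEndomorphism (A : VertexAlgebra V) (D : Derivation ℂ R R)
    (Δ : V →ₗ[ℂ] V ⊗[ℂ] R) : Prop where
  map_vacuum : Δ A.vacuum = A.vacuum ⊗ₜ[ℂ] (1 : R)
  map_mode : ∀ (v w : V) (n : ℤ), Δ (A.mode v n w) = A.tensorMode D n (Δ v) (Δ w)

end Pseudo

/-! ### The differential algebra `ℂ((z^{1/r}))[log z]` -/

/-- The standard `ℂ`-algebra structure of `ℂ((t))` is preferred to the (propositionally equal) one
that comes from an algebra structure on power series. -/
instance laurentAlgebra : Algebra ℂ (LaurentSeries ℂ) := HahnSeries.instAlgebra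

/-- The algebra `ℂ((z^{1/r}))[log z]`: polynomials in the variable `log z` whose coefficients are
Laurent series in the variable `z^{1/r}`. The integer `r` enters through the interpretation of the
variables, that is, through `rootPow` and the derivation `logDerivation`. -/
abbrev LogLaurent : Type := Polynomial (LaurentSeries ℂ)

/-- The element `z^{k/r}` of `ℂ((z^{1/r}))[log z]`. -/
def rootPow (k : ℤ) : LogLaurent := Polynomial.C (HahnSeries.single k (1 : ℂ))

/-- The element `log z` of `ℂ((z^{1/r}))[log z]`. -/
def logVar : LogLaurent := Polynomial.X

/-- The Euler operator `∑ a_k t^k ↦ ∑ k a_k t^k` on `ℂ((t))`. -/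
def eulerOp : LaurentSeries ℂ →ₗ[ℂ] LaurentSeries ℂ where
  toFun f :=
    { coeff := fun k => (k : ℂ) * f.coeff k
      isPWO_support' := f.isPWO_support.mono fun k hk hf => hk (by simp [hf]) }
  map_add' f g := by ext k; simp [mul_add]
  map_smul' c f := by ext k; simp [mul_left_comm]

/-- The Euler operator as a derivation. -/
def eulerDerivation : Derivation ℂ (LaurentSeries ℂ) (LaurentSeries ℂ) :=
  Derivation.mk' eulerOp fun f g => by
    have hs : ∀ f : LaurentSeries ℂ, (eulerOp f).support ⊆ f.support :=
      fun f k hk hf => hk (by simp [eulerOp, hf])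
    ext k
    rw [smul_eq_mul, smul_eq_mul, mul_comm g, HahnSeries.coeff_add,
      HahnSeries.coeff_mul_right' g.isPWO_support (hs g),
      HahnSeries.coeff_mul_left' f.isPWO_support (hs f)]
    change (k : ℂ) * (f * g).coeff k = _
    rw [HahnSeries.coeff_mul, Finset.mul_sum, ← Finset.sum_add_distrib]
    refine Finset.sum_congr rfl fun ij hij => ?_
    have h : ij.1 + ij.2 = k := (Finset.mem_antidiagonal.1 hij).2.2
    change _ = f.coeff ij.1 * ((ij.2 : ℂ) * g.coeff ij.2) + (ij.1 : ℂ) * f.coeff ij.1 * g.coeff ij.2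
    rw [← h]
    push_cast
    ring

/-- The derivation `d/dz` of `ℂ((z^{1/r}))`; as `z = t^r` for `t = z^{1/r}`, it is
`r⁻¹ z⁻¹ (t d/dt)`. -/
def rootDerivation (r : ℕ) : Derivation ℂ (LaurentSeries ℂ) (LaurentSeries ℂ) :=
  HahnSeries.single (-(r : ℤ)) ((r : ℂ)⁻¹) • eulerDerivation

theorem coeff_sum_monomial (D : Derivation ℂ (LaurentSeries ℂ) (LaurentSeries ℂ))
    (p : LogLaurent) (n : ℕ) :
    (p.sum fun m g => Polynomial.monomial m (D g)).coeff n = D (p.coeff n) := by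
  rw [Polynomial.sum_def, Polynomial.finsetSum_coeff]
  simp only [Polynomial.coeff_monomial]
  rw [Finset.sum_ite_eq' p.support n]
  split_ifs with h
  · rfl
  · rw [Polynomial.notMem_support_iff.1 h, map_zero]

/-- The derivation `∂` of `ℂ((z^{1/r}))[log z]` which restricts to `d/dz` on `ℂ((z^{1/r}))` and
satisfies `∂ log z = z⁻¹`, that is,
`∂ (∑ g_n (log z)^n) = ∑ (g_n' (log z)^n + n z⁻¹ g_n (log z)^{n-1})`. -/
def logDerivation (r : ℕ) : Derivation ℂ LogLaurent LogLaurent :=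
  Derivation.mk'
    { toFun := fun p => (p.sum fun n g => Polynomial.monomial n (rootDerivation r g)) +
        rootPow (-(r : ℤ)) * Polynomial.derivative p
      map_add' := fun p q => by
        rw [Polynomial.sum_add_index p q _ (by simp) (by simp), Polynomial.derivative_add]
        ring
      map_smul' := fun c p => by
        have h : ((c • p).sum fun n g => Polynomial.monomial n (rootDerivation r g)) =
            c • p.sum fun n g => Polynomial.monomial n (rootDerivation r g) := by
          ext n : 1
          rw [Polynomial.coeff_smul, coeff_sum_monomial, coeff_sum_monomial,
            Polynomial.coeff_smul, Derivation.map_smul]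
        rw [h, Polynomial.derivative_smul, RingHom.id_apply, smul_add, mul_smul_comm] }
    (fun p q => by
      have h : ((p * q).sum fun n g => Polynomial.monomial n (rootDerivation r g)) =
          p * (q.sum fun n g => Polynomial.monomial n (rootDerivation r g)) +
          q * (p.sum fun n g => Polynomial.monomial n (rootDerivation r g)) := by
        ext n : 1
        rw [mul_comm q, Polynomial.coeff_add, coeff_sum_monomial, Polynomial.coeff_mul,
          Polynomial.coeff_mul, Polynomial.coeff_mul, map_sum, ← Finset.sum_add_distrib]
        refine Finset.sum_congr rfl fun ij _ => ?_
        rw [coeff_sum_monomial, coeff_sum_monomial, Derivation.leibniz, smul_eq_mul, smul_eq_mul,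
          mul_comm (q.coeff _)]
      simp only [LinearMap.coe_mk, AddHom.coe_mk, smul_eq_mul]
      rw [h, Polynomial.derivative_mul]
      ring)

theorem rootDerivation_coeff (r : ℕ) (f : LaurentSeries ℂ) (k : ℤ) :
    (rootDerivation r f).coeff k = (r : ℂ)⁻¹ * (((k + r : ℤ) : ℂ) * f.coeff (k + r)) := by
  have h : (rootDerivation r f) = HahnSeries.single (-(r : ℤ)) ((r : ℂ)⁻¹) * eulerOp f := rfl
  rw [h, HahnSeries.coeff_single_mul, sub_neg_eq_add]
  rfl

theorem logDerivation_C (r : ℕ) (f : LaurentSeries ℂ) :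
    logDerivation r (Polynomial.C f) = Polynomial.C (rootDerivation r f) := by
  change (Polynomial.sum (Polynomial.C f) fun n g => Polynomial.monomial n (rootDerivation r g)) +
    rootPow (-(r : ℤ)) * Polynomial.derivative (Polynomial.C f) = _
  simp

theorem logDerivation_logVar (r : ℕ) : logDerivation r logVar = rootPow (-(r : ℤ)) := by
  change (Polynomial.sum Polynomial.X fun n g => Polynomial.monomial n (rootDerivation r g)) +
    rootPow (-(r : ℤ)) * Polynomial.derivative (Polynomial.X) = _
  simp [Polynomial.X, Polynomial.sum_monomial_index]

theorem mulLeft_injective {r : ℕ} (hr : 0 < r) :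
    Function.Injective (AddMonoidHom.mulLeft (r : ℤ)) := fun a b h =>
  mul_left_cancel₀ (by exact_mod_cast hr.ne' : (r : ℤ) ≠ 0) h

theorem mulLeft_le_iff {r : ℕ} (hr : 0 < r) (a b : ℤ) :
    AddMonoidHom.mulLeft (r : ℤ) a ≤ AddMonoidHom.mulLeft (r : ℤ) b ↔ a ≤ b :=
  mul_le_mul_iff_right₀ (by exact_mod_cast hr : (0 : ℤ) < r)

/-- The embedding of `ℂ((z))` into `ℂ((z^{1/r}))[log z]`, which makes the latter an algebra over
`ℂ((z))`. -/
def ofLaurent {r : ℕ} (hr : 0 < r) : LaurentSeries ℂ →+* LogLaurent :=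
  Polynomial.C.comp
    (HahnSeries.embDomainRingHom (AddMonoidHom.mulLeft (r : ℤ)) (mulLeft_injective hr)
      (mulLeft_le_iff hr))

/-- On `ℂ((z))` the derivation `∂` is `d/dz`. -/
theorem logDerivation_ofLaurent {r : ℕ} (hr : 0 < r) (f : LaurentSeries ℂ) :
    logDerivation r (ofLaurent hr f) = ofLaurent hr (LaurentSeries.derivative ℂ f) := by
  let e : ℤ ↪o ℤ := ⟨⟨AddMonoidHom.mulLeft (r : ℤ), mulLeft_injective hr⟩, mulLeft_le_iff hr _ _⟩
  change logDerivation r (Polynomial.C (HahnSeries.embDomain e f)) =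
    Polynomial.C (HahnSeries.embDomain e (LaurentSeries.derivative ℂ f))
  rw [logDerivation_C]
  congr 1
  ext k
  rw [rootDerivation_coeff]
  have hr' : (r : ℂ) ≠ 0 := by exact_mod_cast hr.ne'
  by_cases hk : k ∈ Set.range e
  · obtain ⟨l, rfl⟩ := hk
    have h1 : e l + r = e (l + 1) := by
      change (r : ℤ) * l + r = r * (l + 1)
      ring
    have h2 : ((e (l + 1) : ℤ) : ℂ) = r * (l + 1) := by
      change (((r : ℤ) * (l + 1) : ℤ) : ℂ) = _
      push_cast
      ring
    rw [h1, HahnSeries.embDomain_coeff, HahnSeries.embDomain_coeff, h2,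
      LaurentSeries.derivative_apply, LaurentSeries.hasseDeriv_coeff, Nat.cast_one,
      Ring.choose_one_right, zsmul_eq_mul]
    push_cast
    field_simp
  · have hk' : k + r ∉ Set.range e := by
      rintro ⟨l, hl⟩
      refine hk ⟨l - 1, ?_⟩
      have hl' : (r : ℤ) * l = k + r := hl
      change (r : ℤ) * (l - 1) = k
      linarith
    rw [HahnSeries.embDomain_of_notMem_range hk, HahnSeries.embDomain_of_notMem_range hk', mul_zero,
      mul_zero]

/-! ### Locally finite sums and exponentials of operators -/

section Operators

variable {M N : Type*} [AddCommGroup M] [Module ℂ M] [AddCommGroup N] [Module ℂ N]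

/-- The sum of a family of linear maps of which only finitely many are nonzero on each vector. -/
def pointwiseSum {ι : Type*} (f : ι → M →ₗ[ℂ] N)
    (hf : ∀ v, (Function.support fun i => f i v).Finite) : M →ₗ[ℂ] N where
  toFun v := ∑ᶠ i, f i v
  map_add' v w := by
    simp only [map_add]
    exact finsum_add_distrib (hf v) (hf w)
  map_smul' c v := by
    simp only [map_smul, RingHom.id_apply]
    exact (smul_finsum' c (hf v)).symm

/-- Every vector is annihilated by a power of `T`. -/
def IsLocallyNilpotent (T : Module.End ℂ M) : Prop := ∀ v, ∃ j : ℕ, (T ^ j) v = 0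

/-- Every vector lies in a finite-dimensional `T`-stable subspace. -/
def IsLocallyFinite (T : Module.End ℂ M) : Prop :=
  ∀ v, ∃ U : Submodule ℂ M, v ∈ U ∧ FiniteDimensional ℂ U ∧ U ∈ T.invtSubmodule

theorem pow_apply_eq_zero_of_le {T : Module.End ℂ M} {v : M} {j k : ℕ} (h : (T ^ j) v = 0)
    (hjk : j ≤ k) : (T ^ k) v = 0 := by
  obtain ⟨l, rfl⟩ := Nat.exists_eq_add_of_le' hjk
  rw [pow_add, Module.End.mul_apply, h, map_zero]

theorem IsLocallyNilpotent.finite {T : Module.End ℂ M} (hT : IsLocallyNilpotent T) (v : M) :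
    (Function.support fun j : ℕ => ((j.factorial : ℂ)⁻¹ • T ^ j) v).Finite := by
  obtain ⟨j, hj⟩ := hT v
  refine (Set.finite_lt_nat j).subset fun k hk => ?_
  by_contra hjk
  exact hk (by simp [pow_apply_eq_zero_of_le hj (not_lt.1 hjk)])

/-- To be locally nilpotent it suffices to kill the vectors of a spanning family of subspaces. -/
theorem isLocallyNilpotent_of_iSup {ι : Type*} {T : Module.End ℂ M} {E : ι → Submodule ℂ M}
    (hE : ⨆ i, E i = ⊤) (h : ∀ i, ∀ v ∈ E i, ∃ j : ℕ, (T ^ j) v = 0) :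
    IsLocallyNilpotent T := fun v => by
  refine Submodule.iSup_induction E (motive := fun v => ∃ j : ℕ, (T ^ j) v = 0)
    (hE ▸ Submodule.mem_top : v ∈ ⨆ i, E i) h ⟨0, by simp⟩ ?_
  rintro x y ⟨j, hj⟩ ⟨k, hk⟩
  exact ⟨max j k, by rw [map_add, pow_apply_eq_zero_of_le hj (le_max_left _ _),
    pow_apply_eq_zero_of_le hk (le_max_right _ _), add_zero]⟩

/-- The exponential `∑_j T^j / j!` of a locally nilpotent operator. -/
def expNil (T : Module.End ℂ M) (hT : IsLocallyNilpotent T) : Module.End ℂ M :=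
  pointwiseSum (fun j : ℕ => (j.factorial : ℂ)⁻¹ • T ^ j) hT.finite

theorem coe_mem_maxGenEigenspace {T : Module.End ℂ M} {U : Submodule ℂ M}
    (T' : Module.End ℂ U) (hT' : ∀ u : U, (T' u : M) = T u) {μ : ℂ}
    {u : U} (hu : u ∈ T'.maxGenEigenspace μ) : (u : M) ∈ T.maxGenEigenspace μ := by
  obtain ⟨k, hk⟩ := (Module.End.mem_maxGenEigenspace T' μ u).1 hu
  refine (Module.End.mem_maxGenEigenspace T μ u).2 ⟨k, ?_⟩
  have h : ∀ (k : ℕ) (u : U), (((T' - μ • (1 : Module.End ℂ U)) ^ k) u : M) =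
      ((T - μ • (1 : Module.End ℂ M)) ^ k) (u : M) := by
    intro k
    induction k with
    | zero => intro u; rfl
    | succ k ih =>
      intro u
      rw [pow_succ, pow_succ, Module.End.mul_apply, Module.End.mul_apply, ih]
      congr 1
      simp [hT']
  rw [← h, hk, ZeroMemClass.coe_zero]

theorem IsLocallyFinite.iSup_eq_top {T : Module.End ℂ M} (hT : IsLocallyFinite T) :
    ⨆ μ, T.maxGenEigenspace μ = ⊤ := by
  refine eq_top_iff.2 fun v _ => ?_
  obtain ⟨U, hv, hU, hTU⟩ := hT v
  let T' : Module.End ℂ U := LinearMap.restrict T hTU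
  have h : ⨆ μ, T'.maxGenEigenspace μ = ⊤ := Module.End.iSup_maxGenEigenspace_eq_top T'
  have h2 : (⟨v, hv⟩ : U) ∈ ⨆ μ, T'.maxGenEigenspace μ := h ▸ Submodule.mem_top
  refine Submodule.iSup_induction (fun μ => T'.maxGenEigenspace μ)
    (motive := fun u : U => (u : M) ∈ ⨆ μ, T.maxGenEigenspace μ) h2 ?_ ?_ ?_
  · intro μ u hu
    exact Submodule.mem_iSup_of_mem μ (coe_mem_maxGenEigenspace T' (fun _ => rfl) hu)
  · exact Submodule.zero_mem _
  · intro x y hx hy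
    exact Submodule.add_mem _ hx hy

theorem IsLocallyFinite.bijective {T : Module.End ℂ M} (hT : IsLocallyFinite T) :
    Function.Bijective (DirectSum.coeLinearMap T.maxGenEigenspace) :=
  DirectSum.isInternal_submodule_of_iSupIndep_of_iSup_eq_top T.independent_maxGenEigenspace
    hT.iSup_eq_top

/-- For a locally finite operator `T`, the projection of the space onto the generalized eigenspace
of `T` of eigenvalue `μ` along the sum of the other generalized eigenspaces. -/
def genProj {T : Module.End ℂ M} (hT : IsLocallyFinite T) (μ : ℂ) : Module.End ℂ M :=
  (T.maxGenEigenspace μ).subtype ∘ₗ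
    DirectSum.component ℂ ℂ (fun ν => T.maxGenEigenspace ν) μ ∘ₗ
      (LinearEquiv.ofBijective (DirectSum.coeLinearMap T.maxGenEigenspace)
        hT.bijective).symm.toLinearMap

theorem genProj_finite {T : Module.End ℂ M} (hT : IsLocallyFinite T) (v : M) :
    (Function.support fun μ => genProj hT μ v).Finite := by
  classical
  refine (DFinsupp.support ((LinearEquiv.ofBijective (DirectSum.coeLinearMap T.maxGenEigenspace)
        hT.bijective).symm v)).finite_toSet.subset fun μ hμ => ?_
  rw [Finset.mem_coe, DFinsupp.mem_support_iff]
  intro h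
  exact hμ (congrArg Subtype.val h)

/-- The semisimple part of a locally finite operator `T`: it acts on the generalized eigenspace of
`T` of eigenvalue `μ` as the scalar `μ`. -/
def semisimplePart {T : Module.End ℂ M} (hT : IsLocallyFinite T) : Module.End ℂ M :=
  pointwiseSum (fun μ : ℂ => μ • genProj hT μ) fun v =>
    (genProj_finite hT v).subset fun μ hμ h => hμ (by simp [h])

/-- The (locally) nilpotent part of a locally finite operator. -/
def nilpotentPart {T : Module.End ℂ M} (hT : IsLocallyFinite T) : Module.End ℂ M :=
  T - semisimplePart hT

theorem genProj_of_mem {T : Module.End ℂ M} (hT : IsLocallyFinite T) {μ : ℂ} {v : M}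
    (hv : v ∈ T.maxGenEigenspace μ) (ν : ℂ) : genProj hT ν v = if ν = μ then v else 0 := by
  have h : (LinearEquiv.ofBijective (DirectSum.coeLinearMap T.maxGenEigenspace)
        hT.bijective).symm v = DirectSum.of (fun ν => T.maxGenEigenspace ν) μ ⟨v, hv⟩ := by
    rw [LinearEquiv.symm_apply_eq, LinearEquiv.ofBijective_apply, DirectSum.coeLinearMap_of]
  change ((LinearEquiv.ofBijective (DirectSum.coeLinearMap T.maxGenEigenspace)
        hT.bijective).symm v ν : M) = _
  rw [h]
  split_ifs with hν
  · subst hν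
    rw [DirectSum.of_eq_same]
  · rw [DirectSum.of_eq_of_ne _ _ _ hν, ZeroMemClass.coe_zero]

theorem semisimplePart_of_mem {T : Module.End ℂ M} (hT : IsLocallyFinite T) {μ : ℂ} {v : M}
    (hv : v ∈ T.maxGenEigenspace μ) : semisimplePart hT v = μ • v := by
  change ∑ᶠ ν : ℂ, ν • genProj hT ν v = _
  rw [finsum_eq_single _ μ fun ν hν => by rw [genProj_of_mem hT hv, if_neg hν, smul_zero],
    genProj_of_mem hT hv, if_pos rfl]

theorem nilpotentPart_pow_of_mem {T : Module.End ℂ M} (hT : IsLocallyFinite T) {μ : ℂ} {v : M}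
    (hv : v ∈ T.maxGenEigenspace μ) (j : ℕ) :
    (nilpotentPart hT ^ j) v = ((T - μ • (1 : Module.End ℂ M)) ^ j) v := by
  induction j generalizing v with
  | zero => simp
  | succ j ih =>
    have h : nilpotentPart hT v = (T - μ • (1 : Module.End ℂ M)) v := by
      simp [nilpotentPart, semisimplePart_of_mem hT hv]
    rw [pow_succ, pow_succ, Module.End.mul_apply, Module.End.mul_apply, h, ih]
    exact Module.End.mapsTo_maxGenEigenspace_of_comm
      ((Commute.refl T).sub_right ((Commute.one_right T).smul_right μ)) μ hv

theorem nilpotentPart_isLocallyNilpotent {T : Module.End ℂ M} (hT : IsLocallyFinite T) :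
    IsLocallyNilpotent (nilpotentPart hT) :=
  isLocallyNilpotent_of_iSup hT.iSup_eq_top fun μ v hv => by
    obtain ⟨j, hj⟩ := (Module.End.mem_maxGenEigenspace T μ v).1 hv
    exact ⟨j, by rw [nilpotentPart_pow_of_mem hT hv, hj]⟩

theorem mem_of_semisimplePart_eq {T : Module.End ℂ M} (hT : IsLocallyFinite T) {μ : ℂ} {v : M}
    (hv : semisimplePart hT v = μ • v) : v ∈ T.maxGenEigenspace μ := by
  have hP : ∀ (ν : ℂ) (w : M), genProj hT ν (semisimplePart hT w) = ν • genProj hT ν w := by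
    intro ν w
    refine Submodule.iSup_induction T.maxGenEigenspace
      (motive := fun w => genProj hT ν (semisimplePart hT w) = ν • genProj hT ν w)
      (hT.iSup_eq_top ▸ Submodule.mem_top : w ∈ ⨆ i, T.maxGenEigenspace i) ?_ (by simp) ?_
    · intro κ x hx
      rw [semisimplePart_of_mem hT hx, map_smul, genProj_of_mem hT hx]
      split_ifs with h
      · rw [h]
      · simp
    · intro x y hx hy
      simp only [map_add, smul_add, hx, hy]
  have hsum : ∀ w : M, ∑ᶠ ν : ℂ, genProj hT ν w = w := by
    intro w
    refine Submodule.iSup_induction T.maxGenEigenspace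
      (motive := fun w => ∑ᶠ ν : ℂ, genProj hT ν w = w)
      (hT.iSup_eq_top ▸ Submodule.mem_top : w ∈ ⨆ i, T.maxGenEigenspace i) ?_ (by simp) ?_
    · intro κ x hx
      rw [finsum_eq_single _ κ fun ν hν => by rw [genProj_of_mem hT hx, if_neg hν],
        genProj_of_mem hT hx, if_pos rfl]
    · intro x y hx hy
      simp only [map_add]
      rw [finsum_add_distrib (genProj_finite hT x) (genProj_finite hT y), hx, hy]
  have h0 : ∀ ν, ν ≠ μ → genProj hT ν v = 0 := by
    intro ν hν
    have h := hP ν v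
    rw [hv, map_smul, ← sub_eq_zero, ← sub_smul, smul_eq_zero, sub_eq_zero] at h
    exact h.resolve_left fun h => hν h.symm
  have h := hsum v
  rw [finsum_eq_single _ μ h0] at h
  rw [← h]
  exact Submodule.coe_mem _

/-- `semisimplePart` and `nilpotentPart` induce the semisimple-nilpotent decomposition on every
finite-dimensional stable subspace. -/
theorem semisimplePart_nilpotentPart_restrict {T : Module.End ℂ M} (hT : IsLocallyFinite T)
    (U : Submodule ℂ M) [FiniteDimensional ℂ U] (hU : U ∈ T.invtSubmodule) :
    ∃ s n : Module.End ℂ U, s.IsSemisimple ∧ IsNilpotent n ∧ Commute s n ∧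
      ∀ u : U, (s u : M) = semisimplePart hT u ∧ (n u : M) = nilpotentPart hT u := by
  let T' : Module.End ℂ U := LinearMap.restrict T hU
  obtain ⟨n, hn, s, hs, hnil, hss, hT'⟩ := T'.exists_isNilpotent_isSemisimple
  have hcs : Commute T' s := Algebra.commute_of_mem_adjoin_self hs
  have key : ∀ u : U, (s u : M) = semisimplePart hT u := by
    intro u
    have h : ⨆ μ, T'.maxGenEigenspace μ = ⊤ := Module.End.iSup_maxGenEigenspace_eq_top T'
    have h2 : u ∈ ⨆ μ, T'.maxGenEigenspace μ := h ▸ Submodule.mem_top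
    refine Submodule.iSup_induction (fun μ => T'.maxGenEigenspace μ)
      (motive := fun u : U => (s u : M) = semisimplePart hT u) h2 ?_ ?_ ?_
    · intro μ u hu
      rw [semisimplePart_of_mem hT (coe_mem_maxGenEigenspace T' (fun _ => rfl) hu),
        Module.End.apply_eq_of_mem_of_comm_of_isFinitelySemisimple_of_isNil hu hcs
          hss.isFinitelySemisimple (by rwa [hT', add_sub_cancel_right])]
      rfl
    · simp
    · intro x y hx hy
      simp only [map_add, Submodule.coe_add, hx, hy]
  refine ⟨s, n, hss, hnil, ?_, fun u => ⟨key u, ?_⟩⟩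
  · have h : n = T' - s := by rw [hT', add_sub_cancel_right]
    rw [h]
    exact hcs.symm.sub_right (Commute.refl s)
  · have h : n = T' - s := by rw [hT', add_sub_cancel_right]
    rw [h, LinearMap.sub_apply, Submodule.coe_sub, key u]
    rfl

/-! ### The operator `Δ(h, z)` -/

/-- The operator `T ⊗ a : v ⊗ b ↦ T v ⊗ a b` on `M ⊗ ℂ((z^{1/r}))[log z]`. -/
def tensorOp (T : Module.End ℂ M) (a : LogLaurent) : Module.End ℂ (M ⊗[ℂ] LogLaurent) :=
  TensorProduct.map T (LinearMap.mulLeft ℂ a)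

theorem tensorOp_finite {ι : Type*} (T : ι → Module.End ℂ M) (a : ι → LogLaurent)
    (hT : ∀ v, (Function.support fun i => T i v).Finite) (x : M ⊗[ℂ] LogLaurent) :
    (Function.support fun i => tensorOp (T i) (a i) x).Finite := by
  induction x with
  | zero => simp
  | tmul v b =>
    refine (hT v).subset fun i hi h => hi ?_
    change (T i v) ⊗ₜ[ℂ] (a i * b) = 0
    rw [show T i v = 0 from h, TensorProduct.zero_tmul]
  | add x y hx hy =>
    refine (hx.union hy).subset fun i hi => ?_
    by_contra h
    simp only [Set.mem_union, Function.mem_support, not_or, not_not] at h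
    exact hi (by simp [map_add, h.1, h.2])

theorem tensorOp_pow_tmul (T : Module.End ℂ M) (a : LogLaurent) (j : ℕ) (v : M) (b : LogLaurent) :
    (tensorOp T a ^ j) (v ⊗ₜ[ℂ] b) = (T ^ j) v ⊗ₜ[ℂ] (a ^ j * b) := by
  induction j generalizing v b with
  | zero => simp
  | succ j ih =>
    rw [pow_succ, Module.End.mul_apply]
    change (tensorOp T a ^ j) (T v ⊗ₜ[ℂ] (a * b)) = _
    rw [ih, pow_succ, pow_succ, Module.End.mul_apply, mul_assoc]

/-- The pure tensors `v ⊗ b` with `v` in a spanning family of subspaces generate. -/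
theorem isLocallyNilpotent_tensor {ι : Type*} {S : Module.End ℂ (M ⊗[ℂ] LogLaurent)}
    {E : ι → Submodule ℂ M} (hE : ⨆ i, E i = ⊤)
    (h : ∀ i, ∀ v ∈ E i, ∃ j : ℕ, ∀ b : LogLaurent, (S ^ j) (v ⊗ₜ[ℂ] b) = 0) :
    IsLocallyNilpotent S := fun x => by
  have hv : ∀ v : M, ∃ j : ℕ, ∀ b : LogLaurent, (S ^ j) (v ⊗ₜ[ℂ] b) = 0 := fun v => by
    refine Submodule.iSup_induction E
      (motive := fun v => ∃ j : ℕ, ∀ b : LogLaurent, (S ^ j) (v ⊗ₜ[ℂ] b) = 0)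
      (hE ▸ Submodule.mem_top : v ∈ ⨆ i, E i) h ⟨0, by simp⟩ ?_
    rintro x y ⟨j, hj⟩ ⟨k, hk⟩
    exact ⟨max j k, fun b => by
      rw [TensorProduct.add_tmul, map_add, pow_apply_eq_zero_of_le (hj b) (le_max_left _ _),
        pow_apply_eq_zero_of_le (hk b) (le_max_right _ _), add_zero]⟩
  induction x with
  | zero => exact ⟨0, by simp⟩
  | tmul v b => exact ⟨_, (hv v).choose_spec b⟩
  | add x y hx hy =>
    obtain ⟨j, hj⟩ := hx
    obtain ⟨k, hk⟩ := hy
    exact ⟨max j k, by rw [map_add, pow_apply_eq_zero_of_le hj (le_max_left _ _),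
      pow_apply_eq_zero_of_le hk (le_max_right _ _), add_zero]⟩

theorem zPowSemisimple_finite {r : ℕ} (hr : 0 < r) {T : Module.End ℂ M} (hT : IsLocallyFinite T)
    (x : M ⊗[ℂ] LogLaurent) :
    (Function.support fun k : ℤ => tensorOp (genProj hT ((k : ℂ) / r)) (rootPow k) x).Finite := by
  refine tensorOp_finite _ _ (fun v => ?_) x
  refine (genProj_finite hT v).preimage (f := fun k : ℤ => (k : ℂ) / r) (Function.Injective.injOn ?_)
  intro k l hkl
  have hr' : (r : ℂ) ≠ 0 := by exact_mod_cast hr.ne'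
  exact_mod_cast (div_left_inj' hr').1 hkl

/-- For a locally finite operator `T` with eigenvalues in `(1/r)ℤ`, the operator `z^S` of
`M ⊗ ℂ((z^{1/r}))[log z]`, where `S` is the semisimple part of `T`. It multiplies by `z^{k/r}` on the
eigenspace of `S` of eigenvalue `k/r`, which is the generalized eigenspace of `T`. -/
def zPowSemisimple {r : ℕ} (hr : 0 < r) {T : Module.End ℂ M} (hT : IsLocallyFinite T) :
    Module.End ℂ (M ⊗[ℂ] LogLaurent) :=
  pointwiseSum (fun k : ℤ => tensorOp (genProj hT ((k : ℂ) / r)) (rootPow k))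
    (zPowSemisimple_finite hr hT)

theorem zPowSemisimple_tmul {r : ℕ} (hr : 0 < r) {T : Module.End ℂ M} (hT : IsLocallyFinite T)
    {k : ℤ} {v : M} (hv : semisimplePart hT v = ((k : ℂ) / r) • v) (b : LogLaurent) :
    zPowSemisimple hr hT (v ⊗ₜ[ℂ] b) = v ⊗ₜ[ℂ] (rootPow k * b) := by
  have hr' : (r : ℂ) ≠ 0 := by exact_mod_cast hr.ne'
  have hv' := mem_of_semisimplePart_eq hT hv
  change ∑ᶠ l : ℤ, (genProj hT ((l : ℂ) / r) v) ⊗ₜ[ℂ] (rootPow l * b) = _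
  rw [finsum_eq_single _ k, genProj_of_mem hT hv', if_pos rfl]
  intro l hl
  rw [genProj_of_mem hT hv', if_neg, TensorProduct.zero_tmul]
  intro h
  exact hl (by exact_mod_cast (div_left_inj' hr').1 h)

theorem tensorOp_nilpotentPart_isLocallyNilpotent {T : Module.End ℂ M} (hT : IsLocallyFinite T) :
    IsLocallyNilpotent (tensorOp (nilpotentPart hT) logVar) :=
  isLocallyNilpotent_tensor (E := fun _ : Unit => (⊤ : Submodule ℂ M)) (by simp) fun _ v _ => by
    obtain ⟨j, hj⟩ := nilpotentPart_isLocallyNilpotent hT v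
    exact ⟨j, fun b => by rw [tensorOp_pow_tmul, hj, TensorProduct.zero_tmul]⟩

/-- For a locally finite operator `T` with eigenvalues in `(1/r)ℤ` and with semisimple part `S` and
nilpotent part `N`, the operator `exp(T log z) = z^S exp(N log z)`. -/
def expLog {r : ℕ} (hr : 0 < r) {T : Module.End ℂ M} (hT : IsLocallyFinite T) : Module.End ℂ (M ⊗[ℂ] LogLaurent) :=
  zPowSemisimple hr hT *
    expNil (tensorOp (nilpotentPart hT) logVar) (tensorOp_nilpotentPart_isLocallyNilpotent hT)

end Operators

section Delta

variable {V : Type*} [AddCommGroup V] [Module ℂ V]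

theorem VertexAlgebra.mode_finite (A : VertexAlgebra V) (h v : V) :
    (Function.support fun n : ℕ => A.mode h ((n : ℤ) + 1) v).Finite := by
  refine (Set.finite_lt_nat
    (HahnSeries.order ((HahnModule.of ℂ).symm (A.Y h v))).natAbs).subset fun n hn => ?_
  by_contra hlt
  refine hn (VertexOperator.ncoeff_eq_zero_of_lt_order _ _ _ ?_)
  simp only [Set.mem_ofPred_eq] at hlt
  omega

/-- The operator `∑_{n ≥ 1} ((-1)^{n-1} / n) h_n z^{-n}` on `V ⊗ ℂ((z^{1/r}))[log z]`, where
`z^{-n} = (z^{1/r})^{-rn}`. -/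
def VertexAlgebra.positiveModes (A : VertexAlgebra V) (r : ℕ) (h : V) :
    Module.End ℂ (V ⊗[ℂ] LogLaurent) :=
  pointwiseSum
    (fun n : ℕ => ((-1 : ℂ) ^ n / ((n : ℂ) + 1)) •
      tensorOp (A.mode h ((n : ℤ) + 1)) (rootPow (-((r : ℤ) * ((n : ℤ) + 1)))))
    fun x => (tensorOp_finite _
      (fun n : ℕ => rootPow (-((r : ℤ) * ((n : ℤ) + 1)))) (A.mode_finite h) x).subset fun n hn h0 => hn (by
      change ((-1 : ℂ) ^ n / ((n : ℂ) + 1)) • tensorOp _ _ x = 0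
      rw [show tensorOp _ _ x = 0 from h0, smul_zero])

/-- The modes of `h ∈ V_(1)` shift the grading: `h_n V_(m) ⊆ V_(m-n)`. -/
theorem VertexOperatorAlgebra.mode_mem_weight (A : VertexOperatorAlgebra V) {h : V}
    (hh : h ∈ A.weight 1) (n m : ℤ) {v : V} (hv : v ∈ A.weight m) :
    A.mode h n v ∈ A.weight (m - n) := by
  have hL : A.mode A.conformal 1 h = h := by
    have := Module.End.mem_eigenspace_iff.1 hh
    simpa using this
  have hv' : A.mode A.conformal 1 v = (m : ℂ) • v := Module.End.mem_eigenspace_iff.1 hv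
  have ht : A.mode (A.mode A.conformal 0 h) (n + 1) v = (-((n : ℂ) + 1)) • A.mode h n v := by
    have := LinearMap.congr_fun (A.translation h (n + 1)) v
    rw [add_sub_cancel_right] at this
    push_cast at this
    exact this
  have hl : (∑ᶠ i : ℕ, Ring.choose (1 : ℤ) i •
        ((A.Y (((A.Y A.conformal)[[0 + (i : ℤ)]]) h))[[1 + n - (i : ℤ)]]) v) =
      A.mode (A.mode A.conformal 0 h) (n + 1) v + A.mode h n v := by
    have h2 : ∀ i : ℕ, 2 ≤ i → Ring.choose (1 : ℤ) i = 0 := fun i hi => by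
      have := Ring.choose_natCast (R := ℤ) 1 i
      rw [Nat.choose_eq_zero_of_lt (by omega)] at this
      simpa using this
    rw [finsum_eq_sum_of_support_subset (s := Finset.range 2)]
    · rw [Finset.sum_range_succ, Finset.sum_range_one, Ring.choose_zero_right,
        Nat.cast_one, Ring.choose_one_right, one_smul, one_smul]
      congr 1
      · change A.mode (A.mode A.conformal (0 + ((0 : ℕ) : ℤ)) h) (1 + n - ((0 : ℕ) : ℤ)) v = _
        congr 3; simp [add_comm]
      · change A.mode (A.mode A.conformal (0 + 1) h) (1 + n - 1) v = _
        rw [zero_add, hL, add_sub_cancel_left]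
    · intro i hi
      by_contra hi2
      refine hi ?_
      simp only [Finset.coe_range, Set.mem_Iio, not_lt] at hi2
      simp only [h2 i hi2, zero_smul]
  have h0 : ∀ i : ℕ, i ≠ 0 → Ring.choose (0 : ℤ) i = 0 := fun i hi => by
    have := Ring.choose_natCast (R := ℤ) 0 i
    rw [Nat.choose_eq_zero_of_lt (by omega)] at this
    simpa using this
  have hj := A.jacobi A.conformal h v 0 1 n
  rw [hl, finsum_eq_single _ 0 (fun i hi => by rw [h0 i hi, mul_zero, zero_smul]),
    finsum_eq_single _ 0 (fun i hi => by rw [h0 i hi, mul_zero, zero_smul]), ht] at hj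
  simp only [Ring.choose_zero_right, pow_zero, mul_one, Nat.cast_zero, add_zero, sub_zero,
    Int.negOnePow_zero, Units.val_one, one_smul] at hj
  have hj' : (-((n : ℂ) + 1)) • A.mode h n v + A.mode h n v =
      A.mode A.conformal 1 (A.mode h n v) - A.mode h n (A.mode A.conformal 1 v) := hj
  rw [hv', map_smul] at hj'
  refine Module.End.mem_eigenspace_iff.2 ?_
  rw [← sub_add_cancel (A.mode A.conformal 1 (A.mode h n v)) ((m : ℂ) • A.mode h n v), ← hj']
  push_cast
  module

theorem VertexOperatorAlgebra.positiveModes_isLocallyNilpotent (A : VertexOperatorAlgebra V)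
    (r : ℕ) {h : V} (hh : h ∈ A.weight 1) :
    IsLocallyNilpotent (A.positiveModes r h) := by
  obtain ⟨N, hN⟩ := A.truncated
  have key : ∀ (j : ℕ) (m : ℤ), m < N + j → ∀ v ∈ A.weight m, ∀ b : LogLaurent,
      (A.positiveModes r h ^ j) (v ⊗ₜ[ℂ] b) = 0 := by
    intro j
    induction j with
    | zero =>
      intro m hm v hv b
      have : v ∈ (⊥ : Submodule ℂ V) := hN m (by simpa using hm) ▸ hv
      rw [(Submodule.mem_bot ℂ).1 this, TensorProduct.zero_tmul, map_zero]
    | succ j ih =>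
      intro m hm v hv b
      rw [pow_succ, Module.End.mul_apply]
      change (A.positiveModes r h ^ j) (∑ᶠ n : ℕ, ((-1 : ℂ) ^ n / ((n : ℂ) + 1)) •
        (A.mode h ((n : ℤ) + 1) v ⊗ₜ[ℂ] (rootPow (-((r : ℤ) * ((n : ℤ) + 1))) * b))) = 0
      refine finsum_induction (fun x => (A.positiveModes r h ^ j) x = 0) (map_zero _)
        (fun x y hx hy => by rw [map_add, hx, hy, add_zero]) fun n => ?_
      rw [map_smul, ih (m - (n + 1)) (by push_cast at hm; omega) _ (A.mode_mem_weight hh _ _ hv),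
        smul_zero]
  refine isLocallyNilpotent_tensor (E := A.weight) A.grading.submodule_iSup_eq_top fun m v hv => ?_
  exact ⟨(m - N + 1).toNat, key _ m (by omega) v hv⟩

/-- For `h ∈ V_(1)` with `h_0` locally finite, the linear map
`Δ(h, z) = exp(h_0 log z) exp(∑_{n ≥ 1} ((-1)^{n-1} / n) h_n z^{-n})` from `V` to
`V ⊗ ℂ((z^{1/r}))[log z]`. -/
def VertexOperatorAlgebra.Delta (A : VertexOperatorAlgebra V) {r : ℕ} (hr : 0 < r) {h : V}
    (hh : h ∈ A.weight 1) (hfin : IsLocallyFinite (A.mode h 0)) :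
    V →ₗ[ℂ] V ⊗[ℂ] LogLaurent :=
  (expLog hr hfin * expNil (A.positiveModes r h) (A.positiveModes_isLocallyNilpotent r hh)) ∘ₗ
    (TensorProduct.mk ℂ V LogLaurent).flip 1

end Delta
end

/-!
Write `W = V ⊗ R` with `R = ℂ((z^{1/r}))[log z]`. The products `tensorMode` make `W` the tensor product
of `V` with the commutative vertex algebra `(R, ∂)`. So `1 ⊗ ∂` is a derivation of all these products
(`VertexAlgebra.lTensor_tensorModeₗ`), and so is the zero mode
`(h ⊗ z⁻¹)_0 = ∑_{n ≥ 0} (-1)^n h_n z^{-n-1}`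
(`VertexAlgebra.tensorModeₗ_zero_tensorModeₗ`, `VertexAlgebra.tensorModeₗ_zero_eq`).

As the `h_n` commute, `Δ = Δ(h, z)` solves the differential equation `∂ Δ(u) = (h ⊗ z⁻¹)_0 Δ(u)`
(`VertexOperatorAlgebra.tensorDerivation_Delta`). The solutions in `W` of this equation are closed under
all products, because they form the kernel of a derivation. So `Δ(u_n w)` and the `n`-th product of
`Δ(u)` and `Δ(w)` are both solutions, and it remains to compare their leading terms. Let `u` and `w` lie
in the generalized eigenspaces of `h_0` of eigenvalues `a/r` and `b/r`. Then `Δ(u)` is `z^{a/r} u` plus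
terms that have a smaller exponent of `z` or a positive power of `log z` (the subspace `expLT a`). As
`∂` lowers exponents, both solutions have the leading term `z^{(a+b)/r} u_n w`
(`VertexOperatorAlgebra.Delta_sub_mem`, `VertexOperatorAlgebra.tensorModeₗ_sub_mem`).

A solution in the generalized eigenspace of eigenvalue `c/r` without such a leading term vanishes
(`VertexOperatorAlgebra.eq_zero_of_tensorDerivation_eq`): after multiplication by `z^{-c/r}`, the inverse
of the unipotent part of `Δ` turns it into an element of `V ⊗ expLT 0` annihilated by `∂`, whereas the
constants of `∂` in `R` are the complex numbers.
-/

noncomputable section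

/-! ### Leibniz rule for divided powers -/

/-- A double sum that vanishes for `i + j ≥ L`, summed along the diagonals `i + j = k`. -/
theorem sum_range_sum_antidiagonal {M : Type*} [AddCommMonoid M] (g : ℕ → ℕ → M) {L : ℕ}
    (hg : ∀ i j, L ≤ i + j → g i j = 0) :
    ∑ k ∈ Finset.range L, ∑ x ∈ Finset.HasAntidiagonal.antidiagonal k, g x.1 x.2 =
      ∑ i ∈ Finset.range L, ∑ j ∈ Finset.range L, g i j := by
  rw [← Finset.sum_product', Finset.sum_sigma']
  refine Finset.sum_of_injOn (fun x => x.2) ?_ ?_ ?_ fun _ _ => rfl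
  · rintro ⟨k, i, j⟩ h ⟨k', i', j'⟩ h' heq
    simp only [Finset.coe_sigma, Set.mem_sigma_iff, Finset.mem_coe, Finset.HasAntidiagonal.mem_antidiagonal] at h h'
    simp only [Prod.mk.injEq] at heq
    obtain ⟨rfl, rfl⟩ := heq
    obtain rfl : k = k' := h.2.symm.trans h'.2
    rfl
  · rintro ⟨k, i, j⟩ h
    simp only [Finset.coe_sigma, Set.mem_sigma_iff, Finset.mem_coe, Finset.HasAntidiagonal.mem_antidiagonal,
      Finset.mem_range, Finset.coe_product, Set.mem_prod] at h ⊢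
    omega
  · rintro ⟨i, j⟩ _ h
    refine hg i j (not_lt.1 fun hlt => h ⟨⟨i + j, i, j⟩, ?_, rfl⟩)
    simpa using hlt

section Leibniz

variable {R : Type*} [CommRing R] [Algebra ℂ R]

/-- The Leibniz rule `D^(n)(x y) = ∑_{i + j = n} D^(i) x D^(j) y` for the divided powers
`D^(n) = D^n / n!` of a derivation. -/
theorem Derivation.inv_factorial_smul_pow_mul (D : Derivation ℂ R R) (n : ℕ) (x y : R) :
    (n.factorial : ℂ)⁻¹ • ((D : R →ₗ[ℂ] R) ^ n) (x * y) =
      ∑ ij ∈ Finset.HasAntidiagonal.antidiagonal n, ((ij.1.factorial : ℂ)⁻¹ * (ij.2.factorial : ℂ)⁻¹) •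
        (((D : R →ₗ[ℂ] R) ^ ij.1) x * ((D : R →ₗ[ℂ] R) ^ ij.2) y) := by
  have h : ((D : R →ₗ[ℂ] R) ^ n) (x * y) = ∑ ij ∈ Finset.HasAntidiagonal.antidiagonal n,
      n.choose ij.1 • (((D : R →ₗ[ℂ] R) ^ ij.1) x * ((D : R →ₗ[ℂ] R) ^ ij.2) y) := by
    induction n with
    | zero => simp
    | succ n ih =>
      rw [pow_succ', Module.End.mul_apply, ih, map_sum,
        Finset.sum_antidiagonal_choose_succ_nsmul
          (fun i j => ((D : R →ₗ[ℂ] R) ^ i) x * ((D : R →ₗ[ℂ] R) ^ j) y), ← Finset.sum_add_distrib]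
      refine Finset.sum_congr rfl fun ij hij => ?_
      rw [← Finset.HasAntidiagonal.mem_antidiagonal.1 hij, Nat.choose_symm_add, ← smul_add, map_nsmul, pow_succ', pow_succ']
      simp only [Derivation.coeFn_coe, Derivation.leibniz, Module.End.mul_apply, smul_eq_mul]
      congr 2
      ring
  rw [h, Finset.smul_sum]
  refine Finset.sum_congr rfl fun ij hij => ?_
  rw [← Finset.HasAntidiagonal.mem_antidiagonal.1 hij, ← Nat.cast_smul_eq_nsmul ℂ, smul_smul]
  congr 1
  rw [Nat.cast_add_choose]
  have h1 : (((ij.1 + ij.2).factorial : ℕ) : ℂ) ≠ 0 := by exact_mod_cast Nat.factorial_ne_zero _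
  field_simp

end Leibniz

/-! ### Derivations of the products of `V ⊗ R` -/

namespace VertexAlgebra

variable {V : Type*} [AddCommGroup V] [Module ℂ V] (A : VertexAlgebra V)

theorem exists_mode_eq_zero (u w : V) (n : ℤ) : ∃ N : ℕ, ∀ i, N ≤ i → A.mode u (n + (i : ℕ)) w = 0 := by
  refine ⟨n.natAbs + 1 + (HahnSeries.order ((HahnModule.of ℂ).symm (A.Y u w))).natAbs,
    fun i hi => VertexOperator.ncoeff_eq_zero_of_lt_order _ _ _ ?_⟩
  omega

/-- The product `u_n w` as a bilinear map in `u` and `w`. -/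
def modeₗ (n : ℤ) : V →ₗ[ℂ] V →ₗ[ℂ] V :=
  (LinearMap.proj n ∘ₗ VertexOperator.ncoeff) ∘ₗ A.Y

theorem modeₗ_apply (n : ℤ) (u w : V) : A.modeₗ n u w = A.mode u n w := rfl

/-- Borcherds' commutator formula `[u_m, v_n] = ∑_i (m choose i) (u_i v)_{m+n-i}` for `m ≥ 0`, which
is the case `l = 0` of the Jacobi identity. -/
theorem mode_mode (u v w : V) (m : ℕ) (n : ℤ) :
    A.mode u m (A.mode v n w) = A.mode v n (A.mode u m w) +
      ∑ ij ∈ Finset.HasAntidiagonal.antidiagonal m, m.choose ij.1 •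
        A.mode (A.mode u (ij.1 : ℤ) v) (n + (ij.2 : ℤ)) w := by
  have h0 : ∀ i : ℕ, i ≠ 0 → Ring.choose (0 : ℤ) i = 0 := fun i hi => by
    have := Ring.choose_natCast (R := ℤ) 0 i
    rw [Nat.choose_eq_zero_of_lt (by omega)] at this
    simpa using this
  have hj := A.jacobi u v w 0 m n
  rw [finsum_eq_single (fun i : ℕ => ((-1 : ℤ) ^ i * Ring.choose 0 i) • _) 0
      (fun i hi => by rw [h0 i hi, mul_zero, zero_smul]),
    finsum_eq_single (fun i : ℕ => ((Int.negOnePow 0 : ℤ) * (-1 : ℤ) ^ i * Ring.choose 0 i) • _) 0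
      (fun i hi => by rw [h0 i hi, mul_zero, zero_smul]),
    finsum_eq_sum_of_support_subset (s := Finset.range (m + 1))] at hj
  · simp only [Ring.choose_zero_right, pow_zero, mul_one, Nat.cast_zero, add_zero, sub_zero,
      Int.negOnePow_zero, Units.val_one, one_smul, zero_add] at hj
    rw [← sub_eq_iff_eq_add']
    refine hj.symm.trans ?_
    rw [Finset.Nat.sum_antidiagonal_eq_sum_range_succ
      (fun i j => m.choose i • A.mode (A.mode u (i : ℤ) v) (n + (j : ℤ)) w)]
    refine Finset.sum_congr rfl fun i hi => ?_
    have hi' := Finset.mem_range.1 hi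
    rw [Ring.choose_natCast, Nat.cast_smul_eq_nsmul]
    congr 1
    change A.mode (A.mode u (i : ℤ) v) _ w = _
    congr 2
    omega
  · intro i hi
    simp only [Finset.coe_range, Set.mem_Iio]
    by_contra hlt
    refine hi ?_
    beta_reduce
    rw [Ring.choose_natCast, Nat.choose_eq_zero_of_lt (by omega), Nat.cast_zero, zero_smul]

variable {R : Type*} [CommRing R] [Algebra ℂ R] (D : Derivation ℂ R R)

/-- `tensorMode` as a bilinear map. -/
def tensorModeₗ (n : ℤ) : V ⊗[ℂ] R →ₗ[ℂ] V ⊗[ℂ] R →ₗ[ℂ] V ⊗[ℂ] R :=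
  LinearMap.mk₂ ℂ (A.tensorMode D n)
    (fun a a' b => by
      simp only [tensorMode, map_add, LinearMap.add_apply, smul_add]
      exact finsum_add_distrib (A.tensorMode_finite D n a b) (A.tensorMode_finite D n a' b))
    (fun c a b => by
      simp only [tensorMode, map_smul, LinearMap.smul_apply]
      rw [smul_finsum' _ (A.tensorMode_finite D n a b)]
      simp only [smul_comm c])
    (fun a b b' => by
      simp only [tensorMode, map_add, smul_add]
      exact finsum_add_distrib (A.tensorMode_finite D n a b) (A.tensorMode_finite D n a b'))
    (fun c a b => by
      simp only [tensorMode, map_smul]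
      rw [smul_finsum' _ (A.tensorMode_finite D n a b)]
      simp only [smul_comm c])

theorem tensorModeₗ_apply (n : ℤ) (a b : V ⊗[ℂ] R) :
    A.tensorModeₗ D n a b = A.tensorMode D n a b := rfl

theorem tensorModeₗ_tmul (n : ℤ) (u w : V) (f g : R) {N : ℕ}
    (hN : ∀ i, N ≤ i → A.mode u (n + (i : ℕ)) w = 0) :
    A.tensorModeₗ D n (u ⊗ₜ f) (w ⊗ₜ g) = ∑ i ∈ Finset.range N, (i.factorial : ℂ)⁻¹ •
      (A.mode u (n + (i : ℕ)) w ⊗ₜ[ℂ] (((D : R →ₗ[ℂ] R) ^ i) f * g)) := by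
  change ∑ᶠ i : ℕ, (i.factorial : ℂ)⁻¹ •
      (A.mode u (n + (i : ℕ)) w ⊗ₜ[ℂ] (((D : R →ₗ[ℂ] R) ^ i) f * g)) = _
  refine finsum_eq_sum_of_support_subset _ fun i hi => ?_
  simp only [Finset.coe_range, Set.mem_Iio]
  by_contra hlt
  exact hi (by simp only [hN i (by omega), TensorProduct.zero_tmul, smul_zero])

/-- `1 ⊗ ∂` is a derivation of all products of `V ⊗ R`. -/
theorem lTensor_tensorModeₗ (n : ℤ) (a b : V ⊗[ℂ] R) :
    (D : R →ₗ[ℂ] R).lTensor V (A.tensorModeₗ D n a b) =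
      A.tensorModeₗ D n ((D : R →ₗ[ℂ] R).lTensor V a) b +
        A.tensorModeₗ D n a ((D : R →ₗ[ℂ] R).lTensor V b) := by
  induction a with
  | zero => simp
  | add x y hx hy => simp only [map_add, LinearMap.add_apply, hx, hy]; abel
  | tmul u f =>
    induction b with
    | zero => simp
    | add x y hx hy => simp only [map_add, hx, hy]; abel
    | tmul w g =>
      obtain ⟨N, hN⟩ := A.exists_mode_eq_zero u w n
      simp only [LinearMap.lTensor_tmul, Derivation.coeFn_coe]
      rw [A.tensorModeₗ_tmul D n u w _ _ hN, A.tensorModeₗ_tmul D n u w _ _ hN,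
        A.tensorModeₗ_tmul D n u w _ _ hN, map_sum, ← Finset.sum_add_distrib]
      refine Finset.sum_congr rfl fun i _ => ?_
      rw [map_smul, ← smul_add, ← TensorProduct.tmul_add, LinearMap.lTensor_tmul,
        Derivation.coeFn_coe, Derivation.leibniz, smul_eq_mul, smul_eq_mul, mul_comm g, ← Derivation.coeFn_coe D,
        ← Module.End.mul_apply, ← Module.End.mul_apply, ← pow_succ, ← pow_succ',
        add_comm (_ * _) (_ * g)]

/-- The zero mode `∑_i h_i ⊗ ∂^i f / i!` of `h ⊗ f` is a derivation of all products of `V ⊗ R`. By the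
commutator formula in `V` and the Leibniz rule for divided powers, its commutator with a product
and its action on the first factor are sums of the same terms, indexed differently. -/
theorem tensorModeₗ_zero_tensorModeₗ (h : V) (f : R) (n : ℤ) (a b : V ⊗[ℂ] R) :
    A.tensorModeₗ D 0 (h ⊗ₜ f) (A.tensorModeₗ D n a b) =
      A.tensorModeₗ D n (A.tensorModeₗ D 0 (h ⊗ₜ f) a) b +
        A.tensorModeₗ D n a (A.tensorModeₗ D 0 (h ⊗ₜ f) b) := by
  induction a with
  | zero => simp
  | add x y hx hy => simp only [map_add, LinearMap.add_apply, hx, hy]; abel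
  | tmul u p =>
    induction b with
    | zero => simp
    | add x y hx hy => simp only [map_add, hx, hy]; abel
    | tmul w q =>
      have hex : ∃ N : ℕ, (∀ i, N ≤ i → A.mode u (n + (i : ℕ)) w = 0) ∧
          (∀ i, N ≤ i → A.mode h (0 + (i : ℕ)) w = 0) ∧
          (∀ i, N ≤ i → A.mode h (0 + (i : ℕ)) u = 0) ∧
          (∀ j i : ℕ, N ≤ i → A.mode (A.mode h (j : ℤ) u) (n + (i : ℕ)) w = 0) ∧
          (∀ j i : ℕ, N ≤ i → A.mode u (n + (i : ℕ)) (A.mode h (j : ℤ) w) = 0) := by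
        obtain ⟨N₁, h₁⟩ := A.exists_mode_eq_zero u w n
        obtain ⟨N₂, h₂⟩ := A.exists_mode_eq_zero h w 0
        obtain ⟨N₃, h₃⟩ := A.exists_mode_eq_zero h u 0
        choose F hF using fun j : ℕ => A.exists_mode_eq_zero (A.mode h (j : ℤ) u) w n
        choose G hG using fun j : ℕ => A.exists_mode_eq_zero u (A.mode h (j : ℤ) w) n
        have hle : ∀ (F : ℕ → ℕ) {j N : ℕ}, j < N → F j ≤ (Finset.range N).sup F := fun F j N hj =>
          Finset.le_sup (Finset.mem_range.2 hj)
        refine ⟨N₁ + N₂ + N₃ + (Finset.range N₃).sup F + (Finset.range N₂).sup G,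
          fun i hi => h₁ i (by omega), fun i hi => h₂ i (by omega), fun i hi => h₃ i (by omega),
          fun j i hi => ?_, fun j i hi => ?_⟩
        · by_cases hj : j < N₃
          · exact hF j i (by have := hle F hj; omega)
          · have := h₃ j (by omega)
            rw [zero_add] at this
            rw [this, ← modeₗ_apply, map_zero, LinearMap.zero_apply]
        · by_cases hj : j < N₂
          · exact hG j i (by have := hle G hj; omega)
          · have := h₂ j (by omega)
            rw [zero_add] at this
            rw [this, map_zero]
      obtain ⟨N, h₁, h₂, h₃, h₄, h₅⟩ := hex
      simp only [zero_add] at h₂ h₃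
      -- the mode `h_i` also annihilates all `u_{n+m} w` for `i ≥ 2 N`
      have h₆ : ∀ m i : ℕ, N + N ≤ i → A.mode h (0 + (i : ℤ)) (A.mode u (n + (m : ℕ)) w) = 0 := by
        intro m i hi
        rw [zero_add, mode_mode, h₂ i (by omega), map_zero, zero_add]
        refine Finset.sum_eq_zero fun js hjs => ?_
        have hjs' := Finset.HasAntidiagonal.mem_antidiagonal.1 hjs
        by_cases hj : N ≤ js.1
        · rw [h₃ _ hj, ← modeₗ_apply, map_zero, LinearMap.zero_apply, smul_zero]
        · have := h₄ js.1 (m + js.2) (by omega)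
          rw [Nat.cast_add, ← add_assoc] at this
          rw [this, smul_zero]
      -- the common terms of both sides; `j + s` is the index of the mode of `h` on the left, and
      -- `s + m` is the order of the derivative of the product on the right
      let T : ℕ → ℕ → ℕ → V ⊗[ℂ] R := fun j s m =>
        ((j.factorial : ℂ)⁻¹ * ((s.factorial : ℂ)⁻¹ * (m.factorial : ℂ)⁻¹)) •
          (A.mode (A.mode h (j : ℤ) u) (n + ((s + m : ℕ) : ℤ)) w ⊗ₜ[ℂ]
            (((D : R →ₗ[ℂ] R) ^ (s + j)) f * ((D : R →ₗ[ℂ] R) ^ m) p * q))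
      have hT : ∀ j s m, N ≤ j ∨ N ≤ s + m → T j s m = 0 := by
        rintro j s m (hj | hsm)
        · simp only [T]
          rw [h₃ _ hj, ← modeₗ_apply, map_zero, LinearMap.zero_apply, TensorProduct.zero_tmul,
            smul_zero]
        · simp only [T]
          rw [h₄ _ _ hsm, TensorProduct.zero_tmul, smul_zero]
      have e₁ : A.tensorModeₗ D n (A.tensorModeₗ D 0 (h ⊗ₜ f) (u ⊗ₜ p)) (w ⊗ₜ q) =
          ∑ j ∈ Finset.range (N + N), ∑ s ∈ Finset.range (N + N), ∑ m ∈ Finset.range (N + N),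
            T j s m := by
        rw [A.tensorModeₗ_tmul D 0 h u f p (N := N + N) fun i hi => by
          rw [zero_add]; exact h₃ i (by omega), map_sum, LinearMap.sum_apply]
        refine Finset.sum_congr rfl fun j _ => ?_
        rw [zero_add, map_smul, LinearMap.smul_apply,
          A.tensorModeₗ_tmul D n _ w _ q (N := N + N) fun i hi => h₄ j i (by omega),
          ← sum_range_sum_antidiagonal _ fun s m hsm => hT j s m (Or.inr (by omega)),
          Finset.smul_sum]
        refine Finset.sum_congr rfl fun k _ => ?_
        rw [← TensorProduct.tmul_smul, ← smul_mul_assoc, Derivation.inv_factorial_smul_pow_mul,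
          Finset.sum_mul, TensorProduct.tmul_sum, Finset.smul_sum]
        refine Finset.sum_congr rfl fun sm hsm => ?_
        simp only [T]
        rw [smul_mul_assoc, TensorProduct.tmul_smul, smul_smul, Finset.HasAntidiagonal.mem_antidiagonal.1 hsm,
          pow_add, Module.End.mul_apply]
      have e₂ : A.tensorModeₗ D n (u ⊗ₜ p) (A.tensorModeₗ D 0 (h ⊗ₜ f) (w ⊗ₜ q)) =
          ∑ m ∈ Finset.range (N + N), ∑ i ∈ Finset.range (N + N),
            ((m.factorial : ℂ)⁻¹ * (i.factorial : ℂ)⁻¹) •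
              (A.mode u (n + (m : ℕ)) (A.mode h (i : ℤ) w) ⊗ₜ[ℂ]
                (((D : R →ₗ[ℂ] R) ^ i) f * (((D : R →ₗ[ℂ] R) ^ m) p * q))) := by
        rw [A.tensorModeₗ_tmul D 0 h w f q (N := N + N) fun i hi => by
          rw [zero_add]; exact h₂ i (by omega), map_sum, Finset.sum_comm]
        refine Finset.sum_congr rfl fun i _ => ?_
        rw [map_smul, zero_add,
          A.tensorModeₗ_tmul D n u _ p _ (N := N + N) fun m hm => h₅ i m (by omega),
          Finset.smul_sum]
        refine Finset.sum_congr rfl fun m _ => ?_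
        rw [smul_smul, mul_comm (_⁻¹) (_⁻¹), mul_left_comm (((D : R →ₗ[ℂ] R) ^ m) p)]
      have e₃ : A.tensorModeₗ D 0 (h ⊗ₜ f) (A.tensorModeₗ D n (u ⊗ₜ p) (w ⊗ₜ q)) =
          ∑ m ∈ Finset.range (N + N), ∑ i ∈ Finset.range (N + N),
            ((m.factorial : ℂ)⁻¹ * (i.factorial : ℂ)⁻¹) •
              (A.mode h (i : ℤ) (A.mode u (n + (m : ℕ)) w) ⊗ₜ[ℂ]
                (((D : R →ₗ[ℂ] R) ^ i) f * (((D : R →ₗ[ℂ] R) ^ m) p * q))) := by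
        rw [A.tensorModeₗ_tmul D n u w p q (N := N + N) fun i hi => h₁ i (by omega), map_sum]
        refine Finset.sum_congr rfl fun m _ => ?_
        rw [map_smul, A.tensorModeₗ_tmul D 0 h _ f _ (N := N + N) (h₆ m), Finset.smul_sum]
        refine Finset.sum_congr rfl fun i _ => ?_
        rw [smul_smul, zero_add]
      have e₄ : ∑ j ∈ Finset.range (N + N), ∑ s ∈ Finset.range (N + N),
          ∑ m ∈ Finset.range (N + N), T j s m =
          ∑ m ∈ Finset.range (N + N), ∑ i ∈ Finset.range (N + N), ∑ js ∈ Finset.HasAntidiagonal.antidiagonal i,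
            T js.1 js.2 m := by
        rw [Finset.sum_congr rfl fun j _ => Finset.sum_comm, Finset.sum_comm]
        refine Finset.sum_congr rfl fun m _ => ?_
        rw [sum_range_sum_antidiagonal (fun j s => T j s m) fun j s hjs => hT j s m (by omega)]
      rw [e₃, e₁, e₂, e₄, ← Finset.sum_add_distrib]
      refine Finset.sum_congr rfl fun m _ => ?_
      rw [← Finset.sum_add_distrib]
      refine Finset.sum_congr rfl fun i _ => ?_
      rw [mode_mode, TensorProduct.add_tmul, smul_add, add_comm]
      congr 1
      rw [TensorProduct.sum_tmul, Finset.smul_sum]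
      refine Finset.sum_congr rfl fun js hjs => ?_
      obtain rfl := Finset.HasAntidiagonal.mem_antidiagonal.1 hjs
      have hidx : n + ((js.2 + m : ℕ) : ℤ) = n + (m : ℤ) + (js.2 : ℤ) := by push_cast; ring
      simp only [T]
      rw [← Nat.cast_smul_eq_nsmul ℂ, ← TensorProduct.smul_tmul', smul_smul, hidx,
        add_comm js.2 js.1, mul_assoc (((D : R →ₗ[ℂ] R) ^ (js.1 + js.2)) f)]
      congr 1
      rw [Nat.cast_add_choose]
      have h1 : (((js.1 + js.2).factorial : ℕ) : ℂ) ≠ 0 := by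
        exact_mod_cast Nat.factorial_ne_zero _
      field_simp

end VertexAlgebra

/-! ### Leading terms in `ℂ((z^{1/r}))[log z]` -/

section Leading

theorem HahnSeries.coeff_mul_of_add_lt {x y : LaurentSeries ℂ} {a b : ℤ}
    (hx : ∀ k, a < k → x.coeff k = 0) (hy : ∀ k, b < k → y.coeff k = 0) {k : ℤ} (hk : a + b < k) :
    (x * y).coeff k = 0 := by
  rw [HahnSeries.coeff_mul]
  refine Finset.sum_eq_zero fun ij hij => ?_
  have h := (Finset.mem_antidiagonal.1 hij).2.2
  by_cases hi : a < ij.1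
  · rw [hx _ hi, zero_mul]
  · rw [hy _ (by omega), mul_zero]

theorem HahnSeries.coeff_mul_add {x y : LaurentSeries ℂ} {a b : ℤ}
    (hx : ∀ k, a < k → x.coeff k = 0) (hy : ∀ k, b < k → y.coeff k = 0) (hyb : y.coeff b = 0) :
    (x * y).coeff (a + b) = 0 := by
  rw [HahnSeries.coeff_mul]
  refine Finset.sum_eq_zero fun ij hij => ?_
  have h := (Finset.mem_antidiagonal.1 hij).2.2
  by_cases hi : a < ij.1
  · rw [hx _ hi, zero_mul]
  · obtain hj | hj : b < ij.2 ∨ ij.2 = b := by omega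
    · rw [hy _ hj, mul_zero]
    · rw [hj, hyb, mul_zero]

/-- The elements of `ℂ((z^{1/r}))[log z]` all of whose exponents of `z^{1/r}` are at most `c`. -/
def expLE (c : ℤ) : Submodule ℂ LogLaurent where
  carrier := {p | ∀ (n : ℕ) (k : ℤ), c < k → (p.coeff n).coeff k = 0}
  add_mem' hp hq n k hk := by simp [hp n k hk, hq n k hk]
  zero_mem' n k _ := by simp
  smul_mem' a p hp n k hk := by simp [hp n k hk]

/-- The elements of `expLE c` in which the monomial `z^{c/r}` itself, without `log z`, does not
occur. -/
def expLT (c : ℤ) : Submodule ℂ LogLaurent where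
  carrier := {p | p ∈ expLE c ∧ (p.coeff 0).coeff c = 0}
  add_mem' hp hq := ⟨add_mem hp.1 hq.1, by simp [hp.2, hq.2]⟩
  zero_mem' := ⟨zero_mem _, by simp⟩
  smul_mem' a p hp := ⟨Submodule.smul_mem _ a hp.1, by simp [hp.2]⟩

theorem expLT_le_expLE (c : ℤ) : expLT c ≤ expLE c := fun _ hp => hp.1

theorem rootPow_mem_expLE (c : ℤ) : rootPow c ∈ expLE c := fun n k hk => by
  rw [rootPow, Polynomial.coeff_C]
  split_ifs
  · exact HahnSeries.coeff_single_of_ne hk.ne'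
  · simp

theorem rootPow_mem_expLT {k c : ℤ} (hk : k < c) : rootPow k ∈ expLT c := by
  refine ⟨fun n l hl => rootPow_mem_expLE k n l (hk.trans hl), ?_⟩
  rw [rootPow, Polynomial.coeff_C_zero]
  exact HahnSeries.coeff_single_of_ne hk.ne'

theorem logVar_mem_expLT : logVar ∈ expLT 0 := by
  refine ⟨fun n k hk => ?_, by simp [logVar]⟩
  rw [logVar, Polynomial.coeff_X]
  split_ifs
  · exact HahnSeries.coeff_single_of_ne hk.ne'
  · simp

theorem mul_mem_expLE {a b : ℤ} {p q : LogLaurent} (hp : p ∈ expLE a) (hq : q ∈ expLE b) :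
    p * q ∈ expLE (a + b) := fun n k hk => by
  rw [Polynomial.coeff_mul, HahnSeries.coeff_sum]
  exact Finset.sum_eq_zero fun ij _ => HahnSeries.coeff_mul_of_add_lt (hp ij.1) (hq ij.2) hk

theorem mul_mem_expLT {a b : ℤ} {p q : LogLaurent} (hp : p ∈ expLE a) (hq : q ∈ expLT b) :
    p * q ∈ expLT (a + b) := by
  refine ⟨mul_mem_expLE hp hq.1, ?_⟩
  rw [Polynomial.mul_coeff_zero]
  exact HahnSeries.coeff_mul_add (hp 0) (hq.1 0) hq.2

theorem mul_mem_expLT' {a b : ℤ} {p q : LogLaurent} (hp : p ∈ expLT a) (hq : q ∈ expLE b) :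
    p * q ∈ expLT (a + b) := by
  rw [mul_comm p q, add_comm]
  exact mul_mem_expLT hq hp

theorem rootPow_mul (a b : ℤ) : rootPow a * rootPow b = rootPow (a + b) := by
  rw [rootPow, rootPow, rootPow, ← Polynomial.C_mul, HahnSeries.single_mul_single, one_mul]

theorem rootPow_zero : rootPow 0 = 1 := by
  rw [rootPow, HahnSeries.single_zero_one, Polynomial.C_1]

theorem logDerivation_coeff_coeff (r : ℕ) (p : LogLaurent) (n : ℕ) (k : ℤ) :
    ((logDerivation r p).coeff n).coeff k =
      (r : ℂ)⁻¹ * (((k + r : ℤ) : ℂ) * (p.coeff n).coeff (k + r)) +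
        ((n : ℂ) + 1) * (p.coeff (n + 1)).coeff (k + r) := by
  change (((p.sum fun n g => Polynomial.monomial n (rootDerivation r g)) +
    rootPow (-(r : ℤ)) * Polynomial.derivative p).coeff n).coeff k = _
  rw [Polynomial.coeff_add, HahnSeries.coeff_add, coeff_sum_monomial, rootDerivation_coeff, rootPow,
    Polynomial.coeff_C_mul, Polynomial.coeff_derivative, HahnSeries.coeff_single_mul, one_mul,
    sub_neg_eq_add, mul_comm (p.coeff (n + 1)), ← Nat.cast_add_one, ← nsmul_eq_mul,
    HahnSeries.coeff_nsmul]
  simp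

theorem logDerivation_rootPow (r : ℕ) (k : ℤ) :
    logDerivation r (rootPow k) = ((k : ℂ) / r) • rootPow (k - r) := by
  rw [rootPow, logDerivation_C, rootPow, Polynomial.smul_C]
  congr 1
  ext l
  rw [rootDerivation_coeff, HahnSeries.coeff_smul]
  by_cases hl : l = k - r
  · rw [hl, sub_add_cancel, HahnSeries.coeff_single_same, HahnSeries.coeff_single_same,
      smul_eq_mul, div_eq_inv_mul, mul_one, mul_one]
  · rw [HahnSeries.coeff_single_of_ne hl, HahnSeries.coeff_single_of_ne (by omega)]
    simp

theorem logDerivation_mem_expLT {r : ℕ} (hr : 0 < r) {c : ℤ} {p : LogLaurent} (hp : p ∈ expLE c) :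
    logDerivation r p ∈ expLT c := by
  have h : ∀ (n : ℕ) (k : ℤ), c ≤ k → ((logDerivation r p).coeff n).coeff k = 0 := fun n k hk => by
    rw [logDerivation_coeff_coeff, hp _ _ (by omega), hp _ _ (by omega)]
    simp
  exact ⟨fun n k hk => h n k hk.le, h 0 c le_rfl⟩

/-- The constants of `∂` are the complex numbers, so none but `0` lies in `expLT 0`. -/
theorem eq_zero_of_logDerivation_eq_zero {r : ℕ} (hr : 0 < r) {p : LogLaurent} (hp : p ∈ expLT 0)
    (h : logDerivation r p = 0) : p = 0 := by
  have hr' : (r : ℂ) ≠ 0 := by exact_mod_cast hr.ne'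
  have hrec : ∀ (n : ℕ) (m : ℤ), (r : ℂ)⁻¹ * ((m : ℂ) * (p.coeff n).coeff m) +
      ((n : ℂ) + 1) * (p.coeff (n + 1)).coeff m = 0 := fun n m => by
    have := logDerivation_coeff_coeff r p n (m - r)
    rw [h, sub_add_cancel] at this
    rw [← this]
    simp
  have hm : ∀ m : ℤ, m ≠ 0 → ∀ d n : ℕ, p.natDegree < n + d → (p.coeff n).coeff m = 0 := by
    intro m hm d
    induction d with
    | zero =>
      intro n hn
      rw [Polynomial.coeff_eq_zero_of_natDegree_lt (by simpa using hn), HahnSeries.coeff_zero]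
    | succ d ih =>
      intro n hn
      have := hrec n m
      rw [ih (n + 1) (by omega), mul_zero, add_zero] at this
      simpa [hr', hm] using this
  ext n m
  rw [Polynomial.coeff_zero, HahnSeries.coeff_zero]
  by_cases hm0 : m = 0
  · subst hm0
    cases n with
    | zero => exact hp.2
    | succ n =>
      have := hrec n 0
      have hn : (n : ℂ) + 1 ≠ 0 := by exact_mod_cast n.succ_ne_zero
      simpa [hn] using this
  · exact hm m hm0 (p.natDegree + 1) n (by omega)

theorem inv_factorial_smul_logDerivation_pow {r : ℕ} (hr : 0 < r) (i : ℕ) :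
    ((i + 1).factorial : ℂ)⁻¹ • ((logDerivation r : LogLaurent →ₗ[ℂ] LogLaurent) ^ (i + 1))
        (rootPow (-(r : ℤ))) =
      ((-1 : ℂ) ^ i / ((i : ℂ) + 1)) • logDerivation r (rootPow (-((r : ℤ) * ((i : ℤ) + 1)))) := by
  have hr' : (r : ℂ) ≠ 0 := by exact_mod_cast hr.ne'
  have h : ∀ i : ℕ, ((logDerivation r : LogLaurent →ₗ[ℂ] LogLaurent) ^ i) (rootPow (-(r : ℤ))) =
      ((-1 : ℂ) ^ i * i.factorial) • rootPow (-((r : ℤ) * ((i : ℤ) + 1))) := by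
    intro i
    induction i with
    | zero => simp
    | succ i ih =>
      rw [pow_succ', Module.End.mul_apply, ih, map_smul, Derivation.coeFn_coe,
        logDerivation_rootPow, smul_smul]
      congr 1
      · rw [Nat.factorial_succ]
        push_cast
        field_simp
        ring
      · congr 1
        push_cast
        ring
  rw [pow_succ', Module.End.mul_apply, h, map_smul, smul_smul, Derivation.coeFn_coe,
    Nat.factorial_succ]
  congr 1
  have h1 : ((i.factorial : ℕ) : ℂ) ≠ 0 := by exact_mod_cast Nat.factorial_ne_zero _
  have h2 : (i : ℂ) + 1 ≠ 0 := by exact_mod_cast i.succ_ne_zero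
  push_cast
  field_simp

end Leading

/-! ### Exponentials of locally nilpotent operators -/

section Operators

variable {M N : Type*} [AddCommGroup M] [Module ℂ M] [AddCommGroup N] [Module ℂ N]

theorem pointwiseSum_apply {ι : Type*} (f : ι → M →ₗ[ℂ] N)
    (hf : ∀ v, (Function.support fun i => f i v).Finite) (v : M) :
    pointwiseSum f hf v = ∑ᶠ i, f i v := rfl

theorem pointwiseSum_commute {ι : Type*} {f : ι → Module.End ℂ M}
    (hf : ∀ v, (Function.support fun i => f i v).Finite) {g : Module.End ℂ M}
    (h : ∀ i, Commute (f i) g) : Commute (pointwiseSum f hf) g := by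
  refine LinearMap.ext fun v => ?_
  rw [Module.End.mul_apply, Module.End.mul_apply, pointwiseSum_apply, pointwiseSum_apply,
    map_finsum _ (hf v)]
  exact finsum_congr fun i => LinearMap.congr_fun (h i) v

theorem expNil_apply {T : Module.End ℂ M} (hT : IsLocallyNilpotent T) {v : M} {n : ℕ}
    (hn : (T ^ n) v = 0) :
    expNil T hT v = ∑ j ∈ Finset.range n, (j.factorial : ℂ)⁻¹ • (T ^ j) v := by
  change ∑ᶠ j : ℕ, (j.factorial : ℂ)⁻¹ • (T ^ j) v = _
  refine finsum_eq_sum_of_support_subset _ fun j hj => ?_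
  simp only [Finset.coe_range, Set.mem_Iio]
  by_contra hlt
  exact hj (by simp only [pow_apply_eq_zero_of_le hn (not_lt.1 hlt), smul_zero])

theorem expNil_of_apply_eq_zero {T : Module.End ℂ M} (hT : IsLocallyNilpotent T) {v : M}
    (hv : T v = 0) : expNil T hT v = v := by
  rw [expNil_apply hT (n := 1) (by simpa using hv)]
  simp

theorem IsLocallyNilpotent.neg {T : Module.End ℂ M} (hT : IsLocallyNilpotent T) :
    IsLocallyNilpotent (-T) := fun v => by
  obtain ⟨j, hj⟩ := hT v
  exact ⟨j, by rw [neg_pow, Module.End.mul_apply, hj, map_zero]⟩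

/-- If `[E, T] = S` commutes with `T`, then `[E, exp T] = S exp T`. -/
theorem mul_expNil {T E S : Module.End ℂ M} (hT : IsLocallyNilpotent T)
    (hE : E * T = T * E + S) (hS : Commute S T) :
    E * expNil T hT = expNil T hT * E + S * expNil T hT := by
  have hpow : ∀ n : ℕ, E * T ^ (n + 1) = T ^ (n + 1) * E + (n + 1 : ℂ) • (S * T ^ n) := by
    intro n
    induction n with
    | zero => simpa using hE
    | succ n ih =>
      have h1 : T ^ (n + 1) * S = S * T ^ (n + 1) := (hS.pow_right (n + 1)).eq.symm
      have h2 : S * T ^ n * T = S * T ^ (n + 1) := by rw [mul_assoc, ← pow_succ]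
      rw [pow_succ _ (n + 1), ← mul_assoc, ih, add_mul, mul_assoc (T ^ (n + 1)), hE, mul_add,
        ← mul_assoc, smul_mul_assoc, h1, h2]
      push_cast
      module
  refine LinearMap.ext fun v => ?_
  obtain ⟨a, ha⟩ := hT v
  obtain ⟨b, hb⟩ := hT (E v)
  simp only [LinearMap.add_apply, Module.End.mul_apply]
  rw [expNil_apply hT (pow_apply_eq_zero_of_le hb (show b ≤ a + b + 1 by omega)),
    show E (expNil T hT v) = _ from congrArg E
      (expNil_apply hT (pow_apply_eq_zero_of_le ha (show a ≤ a + b + 1 by omega))),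
    expNil_apply hT (pow_apply_eq_zero_of_le ha (show a ≤ a + b by omega)),
    Finset.sum_range_succ', Finset.sum_range_succ', map_add, map_sum, map_sum, add_right_comm,
    ← Finset.sum_add_distrib]
  congr 1
  · refine Finset.sum_congr rfl fun n _ => ?_
    have h := LinearMap.congr_fun (hpow n) v
    simp only [LinearMap.add_apply, Module.End.mul_apply, LinearMap.smul_apply] at h
    rw [map_smul, h, smul_add, smul_smul, map_smul, Nat.factorial_succ]
    congr 2
    have h2 : (n : ℂ) + 1 ≠ 0 := by exact_mod_cast n.succ_ne_zero
    push_cast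
    field_simp
  · simp

theorem expNil_commute {T E : Module.End ℂ M} (hT : IsLocallyNilpotent T) (h : Commute E T) :
    Commute E (expNil T hT) := by
  have := mul_expNil (E := E) (S := 0) hT (by rw [add_zero]; exact h) (Commute.zero_left T)
  rwa [zero_mul, add_zero] at this

theorem sub_mul_expNil {T E S : Module.End ℂ M} (hT : IsLocallyNilpotent T)
    (hE : E * T = T * E + S) (hS : Commute S T) : (E - S) * expNil T hT = expNil T hT * E := by
  rw [sub_mul, mul_expNil hT hE hS, add_sub_cancel_right]

theorem expNil_neg_mul_sub {T E S : Module.End ℂ M} (hT : IsLocallyNilpotent T)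
    (hE : E * T = T * E + S) (hS : Commute S T) :
    expNil (-T) hT.neg * (E - S) = E * expNil (-T) hT.neg := by
  rw [mul_expNil (S := -S) hT.neg (by rw [mul_neg, hE, neg_add, neg_mul]) hS.neg_left.neg_right,
    mul_sub, ← (expNil_commute hT.neg hS.neg_right).eq, neg_mul, sub_eq_add_neg]

theorem sub_mul_eq_of_commute {T E S S' : Module.End ℂ M} (hE : E * T = T * E + S)
    (h : Commute S' T) : (E - S') * T = T * (E - S') + S := by
  rw [sub_mul, hE, h.eq, mul_sub, sub_add_eq_add_sub]

/-- Conjugation by `exp T₁ exp T₂` turns the operator `E` into `E - [E, T₁] - [E, T₂]`. -/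
theorem sub_sub_mul_expNil_mul_expNil {E S₁ S₂ T₁ T₂ : Module.End ℂ M}
    (h₁ : IsLocallyNilpotent T₁) (h₂ : IsLocallyNilpotent T₂) (hE₁ : E * T₁ = T₁ * E + S₁)
    (hE₂ : E * T₂ = T₂ * E + S₂) (h₁₁ : Commute S₁ T₁) (h₂₁ : Commute S₂ T₁)
    (h₂₂ : Commute S₂ T₂) :
    (E - S₁ - S₂) * (expNil T₁ h₁ * expNil T₂ h₂) = expNil T₁ h₁ * expNil T₂ h₂ * E := by
  rw [sub_right_comm, ← mul_assoc, sub_mul_expNil h₁ (sub_mul_eq_of_commute hE₁ h₂₁) h₁₁,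
    mul_assoc, sub_mul_expNil h₂ hE₂ h₂₂, mul_assoc]

/-- The inverse of the conjugation in `sub_sub_mul_expNil_mul_expNil`. -/
theorem expNil_neg_mul_expNil_neg_mul_sub_sub {E S₁ S₂ T₁ T₂ : Module.End ℂ M}
    (h₁ : IsLocallyNilpotent T₁) (h₂ : IsLocallyNilpotent T₂) (hE₁ : E * T₁ = T₁ * E + S₁)
    (hE₂ : E * T₂ = T₂ * E + S₂) (h₁₁ : Commute S₁ T₁) (h₂₁ : Commute S₂ T₁)
    (h₂₂ : Commute S₂ T₂) :
    expNil (-T₂) h₂.neg * (expNil (-T₁) h₁.neg * (E - S₁ - S₂)) =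
      E * (expNil (-T₂) h₂.neg * expNil (-T₁) h₁.neg) := by
  rw [sub_right_comm, expNil_neg_mul_sub h₁ (sub_mul_eq_of_commute hE₁ h₂₁) h₁₁, ← mul_assoc,
    expNil_neg_mul_sub h₂ hE₂ h₂₂, mul_assoc]

/-- If `n` is maximal with `T^n v ≠ 0`, then `T^n (exp T v) = T^n v`. -/
theorem expNil_injective {T : Module.End ℂ M} (hT : IsLocallyNilpotent T) :
    Function.Injective (expNil T hT) := by
  rw [injective_iff_map_eq_zero]
  intro v hv
  by_contra hne
  classical
  have h0 : Nat.find (hT v) ≠ 0 := fun h => hne (by simpa [h] using Nat.find_spec (hT v))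
  obtain ⟨n, hn⟩ := Nat.exists_eq_succ_of_ne_zero h0
  have hz : (T ^ (n + 1)) v = 0 := by
    have := Nat.find_spec (hT v)
    rwa [hn] at this
  refine Nat.find_min (hT v) (m := n) (by omega) ?_
  have h := congrArg (T ^ n) hv
  rw [map_zero, expNil_apply hT hz, map_sum, Finset.sum_range_succ'] at h
  simp only [Nat.factorial_zero, Nat.cast_one, inv_one, one_smul, pow_zero, Module.End.one_apply] at h
  rwa [Finset.sum_eq_zero fun k _ => ?_, zero_add] at h
  rw [map_smul, ← Module.End.mul_apply, ← pow_add,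
    pow_apply_eq_zero_of_le hz (show n + 1 ≤ n + (k + 1) by omega), smul_zero]

/-- If `T` maps `Q` into a smaller subspace `P`, then `exp T` is the identity of `Q` modulo `P`. -/
theorem expNil_sub_mem {T : Module.End ℂ M} (hT : IsLocallyNilpotent T) {P Q : Submodule ℂ M}
    (hPQ : P ≤ Q) (h : ∀ v ∈ Q, T v ∈ P) {v : M} (hv : v ∈ Q) : expNil T hT v - v ∈ P := by
  obtain ⟨n, hn⟩ := hT v
  have hpow : ∀ j : ℕ, (T ^ (j + 1)) v ∈ P := by
    intro j
    induction j with
    | zero => simpa using h v hv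
    | succ j ih =>
      rw [pow_succ', Module.End.mul_apply]
      exact h _ (hPQ ih)
  rw [expNil_apply hT (pow_apply_eq_zero_of_le hn n.le_succ), Finset.sum_range_succ']
  simp only [Nat.factorial_zero, Nat.cast_one, inv_one, one_smul, pow_zero, Module.End.one_apply,
    add_sub_cancel_right]
  exact Submodule.sum_mem _ fun j _ => Submodule.smul_mem _ _ (hpow j)

theorem expNil_mem {T : Module.End ℂ M} (hT : IsLocallyNilpotent T) {P : Submodule ℂ M}
    (h : ∀ v ∈ P, T v ∈ P) {v : M} (hv : v ∈ P) : expNil T hT v ∈ P := by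
  have := add_mem (expNil_sub_mem hT le_rfl h hv) hv
  rwa [sub_add_cancel] at this

theorem semisimplePart_commute {T E : Module.End ℂ M} (hT : IsLocallyFinite T) (h : Commute T E) :
    Commute (semisimplePart hT) E := by
  refine LinearMap.ext fun v => ?_
  simp only [Module.End.mul_apply]
  refine Submodule.iSup_induction T.maxGenEigenspace
    (motive := fun v => semisimplePart hT (E v) = E (semisimplePart hT v))
    (hT.iSup_eq_top ▸ Submodule.mem_top : v ∈ ⨆ i, T.maxGenEigenspace i) (fun μ v hv => ?_)
    (by simp) fun x y hx hy => by simp only [map_add, hx, hy]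
  rw [semisimplePart_of_mem hT hv, map_smul,
    semisimplePart_of_mem hT (Module.End.mapsTo_maxGenEigenspace_of_comm h μ hv)]

theorem nilpotentPart_commute {T E : Module.End ℂ M} (hT : IsLocallyFinite T) (h : Commute T E) :
    Commute (nilpotentPart hT) E :=
  h.sub_left (semisimplePart_commute hT h)

/-- The generalized eigenspaces whose eigenvalues are eigenvalues already span. -/
theorem IsLocallyFinite.iSup_div_eq_top {T : Module.End ℂ M} (hT : IsLocallyFinite T) {r : ℕ}
    (h : ∀ μ : ℂ, T.HasEigenvalue μ → ∃ k : ℤ, μ = (k : ℂ) / (r : ℂ)) :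
    ⨆ k : ℤ, T.maxGenEigenspace ((k : ℂ) / r) = ⊤ := by
  rw [eq_top_iff, ← hT.iSup_eq_top]
  refine iSup_le fun μ => ?_
  by_cases hμ : T.HasEigenvalue μ
  · obtain ⟨k, rfl⟩ := h μ hμ
    exact le_iSup (fun k : ℤ => T.maxGenEigenspace ((k : ℂ) / r)) k
  · have h0 : T.eigenspace μ = ⊥ := by
      rw [Module.End.hasEigenvalue_iff, not_not] at hμ
      exact hμ
    intro v hv
    obtain ⟨k, hk⟩ := (Module.End.mem_maxGenEigenspace T μ v).1 hv
    have hinj : Function.Injective (T - μ • (1 : Module.End ℂ M)) := by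
      rw [injective_iff_map_eq_zero]
      intro w hw
      rw [← Submodule.mem_bot ℂ, ← h0, Module.End.mem_eigenspace_iff]
      simpa [sub_eq_zero] using hw
    have hinj' : Function.Injective ((T - μ • (1 : Module.End ℂ M)) ^ k) := by
      rw [Module.End.coe_pow]
      exact hinj.iterate k
    rw [hinj' (hk.trans (map_zero _).symm)]
    exact zero_mem _

/-! ### Operators on `M ⊗ ℂ((z^{1/r}))[log z]` -/

/-- The span of the `v ⊗ f` with `v ∈ U` and `f ∈ Q`. -/
abbrev tensorSpan (U : Submodule ℂ M) (Q : Submodule ℂ LogLaurent) :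
    Submodule ℂ (M ⊗[ℂ] LogLaurent) :=
  Submodule.map₂ (TensorProduct.mk ℂ M LogLaurent) U Q

theorem tmul_mem_tensorSpan {U : Submodule ℂ M} {Q : Submodule ℂ LogLaurent} {v : M}
    {f : LogLaurent} (hv : v ∈ U) (hf : f ∈ Q) : v ⊗ₜ[ℂ] f ∈ tensorSpan U Q :=
  Submodule.apply_mem_map₂ _ hv hf

theorem map_mem_of_mem_tensorSpan {U : Submodule ℂ M} {Q : Submodule ℂ LogLaurent}
    {L : M ⊗[ℂ] LogLaurent →ₗ[ℂ] N} {P : Submodule ℂ N}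
    (h : ∀ v ∈ U, ∀ f ∈ Q, L (v ⊗ₜ f) ∈ P) {x : M ⊗[ℂ] LogLaurent} (hx : x ∈ tensorSpan U Q) :
    L x ∈ P :=
  (Submodule.map₂_le.2 h : tensorSpan U Q ≤ P.comap L) hx

theorem map_eq_of_mem_tensorSpan {U : Submodule ℂ M} {Q : Submodule ℂ LogLaurent}
    {L L' : M ⊗[ℂ] LogLaurent →ₗ[ℂ] N}
    (h : ∀ v ∈ U, ∀ f ∈ Q, L (v ⊗ₜ f) = L' (v ⊗ₜ f)) {x : M ⊗[ℂ] LogLaurent}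
    (hx : x ∈ tensorSpan U Q) : L x = L' x :=
  (Submodule.map₂_le.2 h : tensorSpan U Q ≤ LinearMap.eqLocus L L') hx

theorem tensorOp_tmul (T : Module.End ℂ M) (a : LogLaurent) (v : M) (f : LogLaurent) :
    tensorOp T a (v ⊗ₜ f) = T v ⊗ₜ (a * f) := rfl

theorem tensorOp_commute {T T' : Module.End ℂ M} (h : Commute T T') (a b : LogLaurent) :
    Commute (tensorOp T a) (tensorOp T' b) := by
  refine TensorProduct.ext' fun v f => ?_
  simp only [Module.End.mul_apply, tensorOp_tmul]
  rw [mul_left_comm a b f]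
  congr 1
  exact LinearMap.congr_fun h v

/-- `1 ⊗ ∂` on `M ⊗ ℂ((z^{1/r}))[log z]`. -/
def tensorDerivation (M : Type*) [AddCommGroup M] [Module ℂ M] (r : ℕ) :
    Module.End ℂ (M ⊗[ℂ] LogLaurent) :=
  (logDerivation r : LogLaurent →ₗ[ℂ] LogLaurent).lTensor M

theorem tensorDerivation_apply (r : ℕ) (x : M ⊗[ℂ] LogLaurent) :
    tensorDerivation M r x = (logDerivation r : LogLaurent →ₗ[ℂ] LogLaurent).lTensor M x := rfl

theorem tensorDerivation_tmul (r : ℕ) (v : M) (f : LogLaurent) :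
    tensorDerivation M r (v ⊗ₜ f) = v ⊗ₜ logDerivation r f := rfl

theorem tensorDerivation_mul_tensorOp (r : ℕ) (T : Module.End ℂ M) (a : LogLaurent) :
    tensorDerivation M r * tensorOp T a =
      tensorOp T a * tensorDerivation M r + tensorOp T (logDerivation r a) := by
  refine TensorProduct.ext' fun v f => ?_
  simp only [Module.End.mul_apply, tensorOp_tmul, LinearMap.add_apply, tensorDerivation_tmul]
  rw [← TensorProduct.tmul_add, Derivation.leibniz, smul_eq_mul, smul_eq_mul, mul_comm f]

/-- As `∂` is injective on `expLT 0` and `M` is flat, `1 ⊗ ∂` is injective on `M ⊗ expLT 0`. -/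
theorem eq_zero_of_tensorDerivation_eq_zero {r : ℕ} (hr : 0 < r) {x : M ⊗[ℂ] LogLaurent}
    (hx : x ∈ tensorSpan ⊤ (expLT 0)) (h : tensorDerivation M r x = 0) : x = 0 := by
  have hle : tensorSpan (⊤ : Submodule ℂ M) (expLT 0) ≤
      LinearMap.range ((expLT 0).subtype.lTensor M) :=
    Submodule.map₂_le.2 fun v _ f hf => ⟨v ⊗ₜ ⟨f, hf⟩, rfl⟩
  obtain ⟨y, rfl⟩ := hle hx
  have hinj : Function.Injective
      ((logDerivation r : LogLaurent →ₗ[ℂ] LogLaurent) ∘ₗ (expLT 0).subtype) := by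
    rintro ⟨p, hp⟩ ⟨q, hq⟩ hpq
    have hpq' : logDerivation r p = logDerivation r q := hpq
    have hmem : p - q ∈ expLT 0 :=
      ⟨fun n k hk => by simp [hp.1 n k hk, hq.1 n k hk], by simp [hp.2, hq.2]⟩
    exact Subtype.ext (sub_eq_zero.1
      (eq_zero_of_logDerivation_eq_zero hr hmem ((map_sub _ p q).trans (by rw [hpq', sub_self]))))
  have h' := Module.Flat.lTensor_preserves_injective_linearMap (M := M) _ hinj
  have hy : y = 0 := by
    refine h' ?_
    rw [map_zero, LinearMap.lTensor_comp]
    exact h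
  rw [hy, map_zero]

theorem zPowSemisimple_of_mem {r : ℕ} (hr : 0 < r) {T : Module.End ℂ M} (hT : IsLocallyFinite T)
    {c : ℤ} {Q : Submodule ℂ LogLaurent} {x : M ⊗[ℂ] LogLaurent}
    (hx : x ∈ tensorSpan (T.maxGenEigenspace ((c : ℂ) / r)) Q) :
    zPowSemisimple hr hT x = tensorOp 1 (rootPow c) x := by
  refine map_eq_of_mem_tensorSpan (fun v hv f _ => ?_) hx
  rw [zPowSemisimple_tmul hr hT (semisimplePart_of_mem hT hv), tensorOp_tmul,
    Module.End.one_apply]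

end Operators

/-! ### The generalized eigenspaces of `h_0` -/

namespace VertexAlgebra

variable {V : Type*} [AddCommGroup V] [Module ℂ V] (A : VertexAlgebra V)

theorem zero_mode_mode (h u w : V) (n : ℤ) :
    A.mode h 0 (A.mode u n w) = A.mode (A.mode h 0 u) n w + A.mode u n (A.mode h 0 w) := by
  have := A.mode_mode h u w 0 n
  simpa [add_comm] using this

/-- As `h_0` is a derivation of the products of `V`, its generalized eigenvalues add up. -/
theorem mode_mem_maxGenEigenspace (h : V) {α β : ℂ} {u w : V}
    (hu : u ∈ (A.mode h 0).maxGenEigenspace α) (hw : w ∈ (A.mode h 0).maxGenEigenspace β) (n : ℤ) :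
    A.mode u n w ∈ (A.mode h 0).maxGenEigenspace (α + β) := by
  have key : ∀ (s p q : ℕ) (u w : V), p + q = s →
      ((A.mode h 0 - α • (1 : Module.End ℂ V)) ^ p) u = 0 →
      ((A.mode h 0 - β • (1 : Module.End ℂ V)) ^ q) w = 0 →
      ((A.mode h 0 - (α + β) • (1 : Module.End ℂ V)) ^ s) (A.mode u n w) = 0 := by
    intro s
    induction s with
    | zero =>
      intro p q u w hpq hu hw
      obtain ⟨rfl, rfl⟩ : p = 0 ∧ q = 0 := by omega
      rw [pow_zero, Module.End.one_apply] at hu hw ⊢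
      rw [hw, map_zero]
    | succ s ih =>
      intro p q u w hpq hu hw
      rcases p with _ | p
      · rw [pow_zero, Module.End.one_apply] at hu
        rw [hu, ← modeₗ_apply, map_zero, LinearMap.zero_apply, map_zero]
      rcases q with _ | q
      · rw [pow_zero, Module.End.one_apply] at hw
        rw [hw, map_zero, map_zero]
      have hstep : (A.mode h 0 - (α + β) • (1 : Module.End ℂ V)) (A.mode u n w) =
          A.mode ((A.mode h 0 - α • (1 : Module.End ℂ V)) u) n w +
            A.mode u n ((A.mode h 0 - β • (1 : Module.End ℂ V)) w) := by
        simp only [← modeₗ_apply, LinearMap.sub_apply, LinearMap.smul_apply, Module.End.one_apply,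
          map_sub, map_smul]
        simp only [modeₗ_apply, zero_mode_mode]
        module
      rw [pow_succ, Module.End.mul_apply, hstep, map_add,
        ih p (q + 1) _ w (by omega) (by rwa [pow_succ] at hu) hw,
        ih (p + 1) q u _ (by omega) hu (by rwa [pow_succ] at hw), add_zero]
  obtain ⟨p, hp⟩ := (Module.End.mem_maxGenEigenspace _ _ _).1 hu
  obtain ⟨q, hq⟩ := (Module.End.mem_maxGenEigenspace _ _ _).1 hw
  exact (Module.End.mem_maxGenEigenspace _ _ _).2 ⟨p + q, key _ p q u w rfl hp hq⟩

/-- The generalized eigenspace of `h_0` of eigenvalue `c / r`. -/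
abbrev genSpace (h : V) (r : ℕ) (c : ℤ) : Submodule ℂ V :=
  (A.mode h 0).maxGenEigenspace ((c : ℂ) / r)

theorem mode_mem_genSpace {h : V} {r : ℕ} {a b : ℤ} {u w : V} (hu : u ∈ A.genSpace h r a)
    (hw : w ∈ A.genSpace h r b) (n : ℤ) : A.mode u n w ∈ A.genSpace h r (a + b) := by
  have := A.mode_mem_maxGenEigenspace h hu hw n
  rwa [← add_div, ← Int.cast_add] at this

/-! ### Leading terms of products -/

theorem logDerivation_pow_mem_expLT {r : ℕ} (hr : 0 < r) {c : ℤ} {p : LogLaurent}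
    (hp : p ∈ expLE c) (i : ℕ) :
    ((logDerivation r : LogLaurent →ₗ[ℂ] LogLaurent) ^ (i + 1)) p ∈ expLT c := by
  induction i with
  | zero => simpa using logDerivation_mem_expLT hr hp
  | succ i ih =>
    rw [pow_succ', Module.End.mul_apply]
    exact logDerivation_mem_expLT hr (expLT_le_expLE c ih)

/-- All terms of `(u ⊗ p)_n (w ⊗ q)` but the first contain a derivative of `p`, and `∂` lowers the
exponents of `z`. -/
theorem tensorModeₗ_tmul_sub_mem {r : ℕ} (hr : 0 < r) {a b : ℤ} {u w : V} {p q : LogLaurent}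
    (hp : p ∈ expLE a) (hq : q ∈ expLE b) {n : ℤ} {U : Submodule ℂ V}
    (hU : ∀ m, A.mode u m w ∈ U) :
    A.tensorModeₗ (logDerivation r) n (u ⊗ₜ p) (w ⊗ₜ q) - A.mode u n w ⊗ₜ[ℂ] (p * q) ∈
      tensorSpan U (expLT (a + b)) := by
  obtain ⟨N, hN⟩ := A.exists_mode_eq_zero u w n
  rw [A.tensorModeₗ_tmul _ n u w p q (N := N + 1) fun i hi => hN i (by omega),
    Finset.sum_range_succ']
  have h0 : ((Nat.factorial 0 : ℕ) : ℂ)⁻¹ • (A.mode u (n + ((0 : ℕ) : ℤ)) w ⊗ₜ[ℂ]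
      (((logDerivation r : LogLaurent →ₗ[ℂ] LogLaurent) ^ 0) p * q)) =
      A.mode u n w ⊗ₜ[ℂ] (p * q) := by simp
  rw [h0, add_sub_cancel_right]
  exact Submodule.sum_mem _ fun i _ => Submodule.smul_mem _ _
    (tmul_mem_tensorSpan (hU _) (mul_mem_expLT' (logDerivation_pow_mem_expLT hr hp i) hq))

theorem tensorModeₗ_mem_left {r : ℕ} (hr : 0 < r) {h : V} {a b : ℤ} {x y : V ⊗[ℂ] LogLaurent}
    (hx : x ∈ tensorSpan (A.genSpace h r a) (expLT a))
    (hy : y ∈ tensorSpan (A.genSpace h r b) (expLE b)) (n : ℤ) :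
    A.tensorModeₗ (R := LogLaurent) (logDerivation r) n x y ∈ tensorSpan (A.genSpace h r (a + b)) (expLT (a + b)) := by
  refine map_mem_of_mem_tensorSpan (fun w hw q hq => ?_) hy
  refine map_mem_of_mem_tensorSpan (L := (A.tensorModeₗ (logDerivation r) n).flip (w ⊗ₜ q))
    (fun u hu p hp => ?_) hx
  have hU := A.mode_mem_genSpace hu hw
  have := add_mem (A.tensorModeₗ_tmul_sub_mem hr (expLT_le_expLE a hp) hq (n := n) hU)
    (tmul_mem_tensorSpan (hU n) (mul_mem_expLT' hp hq))
  rwa [sub_add_cancel] at this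

theorem tensorModeₗ_mem_right {r : ℕ} (hr : 0 < r) {h : V} {a b : ℤ} {x y : V ⊗[ℂ] LogLaurent}
    (hx : x ∈ tensorSpan (A.genSpace h r a) (expLE a))
    (hy : y ∈ tensorSpan (A.genSpace h r b) (expLT b)) (n : ℤ) :
    A.tensorModeₗ (R := LogLaurent) (logDerivation r) n x y ∈ tensorSpan (A.genSpace h r (a + b)) (expLT (a + b)) := by
  refine map_mem_of_mem_tensorSpan (fun w hw q hq => ?_) hy
  refine map_mem_of_mem_tensorSpan (L := (A.tensorModeₗ (logDerivation r) n).flip (w ⊗ₜ q))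
    (fun u hu p hp => ?_) hx
  have hU := A.mode_mem_genSpace hu hw
  have := add_mem (A.tensorModeₗ_tmul_sub_mem hr hp (expLT_le_expLE b hq) (n := n) hU)
    (tmul_mem_tensorSpan (hU n) (mul_mem_expLT hp hq))
  rwa [sub_add_cancel] at this

/-! ### Sums of positive modes -/

theorem modeSum_finite (h : V) (c : ℕ → ℂ) (b : ℕ → LogLaurent) (x : V ⊗[ℂ] LogLaurent) :
    (Function.support fun n : ℕ => (c n • tensorOp (A.mode h ((n : ℤ) + 1)) (b n)) x).Finite :=
  (tensorOp_finite _ b (A.mode_finite h) x).subset fun n hn h0 => hn (by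
    change c n • tensorOp _ _ x = 0
    rw [show tensorOp _ _ x = 0 from h0, smul_zero])

/-- The operator `∑_{n ≥ 0} c_n h_{n+1} ⊗ b_n` on `V ⊗ ℂ((z^{1/r}))[log z]`. -/
def modeSum (h : V) (c : ℕ → ℂ) (b : ℕ → LogLaurent) : Module.End ℂ (V ⊗[ℂ] LogLaurent) :=
  pointwiseSum (fun n : ℕ => c n • tensorOp (A.mode h ((n : ℤ) + 1)) (b n)) (A.modeSum_finite h c b)

theorem modeSum_tmul (h : V) (c : ℕ → ℂ) (b : ℕ → LogLaurent) (v : V) (f : LogLaurent) :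
    A.modeSum h c b (v ⊗ₜ f) = ∑ᶠ n : ℕ, c n • (A.mode h ((n : ℤ) + 1) v ⊗ₜ[ℂ] (b n * f)) := rfl

theorem modeSum_commute_tensorOp {h : V} (c : ℕ → ℂ) (b : ℕ → LogLaurent) {T : Module.End ℂ V}
    (hT : ∀ n : ℕ, Commute (A.mode h (n : ℤ)) T) (a : LogLaurent) :
    Commute (A.modeSum h c b) (tensorOp T a) :=
  pointwiseSum_commute _ fun n => (tensorOp_commute (by exact_mod_cast hT (n + 1)) _ _).smul_left _

theorem modeSum_commute_modeSum {h : V} (hT : ∀ m n : ℕ, Commute (A.mode h (m : ℤ)) (A.mode h (n : ℤ)))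
    (c : ℕ → ℂ) (b : ℕ → LogLaurent) (c' : ℕ → ℂ) (b' : ℕ → LogLaurent) :
    Commute (A.modeSum h c b) (A.modeSum h c' b') :=
  (pointwiseSum_commute _ fun n => ((A.modeSum_commute_tensorOp c b
    (fun m => by exact_mod_cast hT m (n + 1)) _).symm.smul_left _)).symm

theorem tensorDerivation_mul_modeSum (r : ℕ) (h : V) (c : ℕ → ℂ) (b : ℕ → LogLaurent) :
    tensorDerivation V r * A.modeSum h c b =
      A.modeSum h c b * tensorDerivation V r + A.modeSum h c fun n => logDerivation r (b n) := by
  refine LinearMap.ext fun x => ?_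
  rw [LinearMap.add_apply, Module.End.mul_apply, Module.End.mul_apply, modeSum, pointwiseSum_apply,
    map_finsum _ (A.modeSum_finite h c b x), pointwiseSum_apply, modeSum, pointwiseSum_apply,
    ← finsum_add_distrib (A.modeSum_finite h c b _) (A.modeSum_finite h c _ x)]
  refine finsum_congr fun n => ?_
  have := LinearMap.congr_fun
    (tensorDerivation_mul_tensorOp r (A.mode h ((n : ℤ) + 1)) (b n)) x
  rw [LinearMap.smul_apply, map_smul, ← Module.End.mul_apply, this, LinearMap.add_apply, smul_add]
  rfl

theorem modeSum_tmul_mem {h : V} (c : ℕ → ℂ) {b : ℕ → LogLaurent} {v : V} {f : LogLaurent}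
    {U : Submodule ℂ V} {Q : Submodule ℂ LogLaurent} (hv : ∀ n : ℕ, A.mode h (n : ℤ) v ∈ U)
    (hf : ∀ n, b n * f ∈ Q) : A.modeSum h c b (v ⊗ₜ f) ∈ tensorSpan U Q := by
  rw [modeSum_tmul]
  exact finsum_induction (· ∈ tensorSpan U Q) (zero_mem _) (fun _ _ => add_mem) fun n =>
    Submodule.smul_mem _ _ (tmul_mem_tensorSpan (by exact_mod_cast hv (n + 1)) (hf n))

/-- The derivative `∑_{n ≥ 1} (-1)^n h_n z^{-n-1}` of the operator `positiveModes`. -/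
def positiveModesDeriv (r : ℕ) (h : V) : Module.End ℂ (V ⊗[ℂ] LogLaurent) :=
  A.modeSum h (fun n => (-1 : ℂ) ^ n / ((n : ℂ) + 1)) fun n =>
    logDerivation r (rootPow (-((r : ℤ) * ((n : ℤ) + 1))))

theorem positiveModes_eq (r : ℕ) (h : V) :
    A.positiveModes r h = A.modeSum h (fun n => (-1 : ℂ) ^ n / ((n : ℂ) + 1))
      fun n => rootPow (-((r : ℤ) * ((n : ℤ) + 1))) := rfl

/-- The zero mode of `h ⊗ z⁻¹` in `V ⊗ ℂ((z^{1/r}))[log z]`. -/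
theorem tensorModeₗ_zero_eq {r : ℕ} (hr : 0 < r) (h : V) :
    A.tensorModeₗ (logDerivation r) 0 (h ⊗ₜ rootPow (-(r : ℤ))) =
      tensorOp (A.mode h 0) (rootPow (-(r : ℤ))) + A.positiveModesDeriv r h := by
  refine TensorProduct.ext' fun v f => ?_
  obtain ⟨N, hN⟩ := A.exists_mode_eq_zero h v 0
  rw [A.tensorModeₗ_tmul _ 0 h v _ f (N := N + 1) fun i hi => hN i (by omega),
    Finset.sum_range_succ', LinearMap.add_apply, add_comm, positiveModesDeriv, modeSum_tmul,
    finsum_eq_sum_of_support_subset (s := Finset.range N)]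
  · congr 1
    · simp [tensorOp_tmul]
    · refine Finset.sum_congr rfl fun i _ => ?_
      rw [← TensorProduct.tmul_smul, ← TensorProduct.tmul_smul, ← smul_mul_assoc, ← smul_mul_assoc,
        inv_factorial_smul_logDerivation_pow hr, zero_add, Nat.cast_succ]
  · intro i hi
    simp only [Finset.coe_range, Set.mem_Iio]
    by_contra hlt
    have h0 := hN (i + 1) (by omega)
    rw [zero_add, Nat.cast_succ] at h0
    exact hi (by simp only [h0, TensorProduct.zero_tmul, smul_zero])

end VertexAlgebra

namespace VertexOperatorAlgebra

variable {V : Type*} [AddCommGroup V] [Module ℂ V] (A : VertexOperatorAlgebra V)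
  {r : ℕ} {h : V}

theorem tensorOp_rootPow_neg (c : ℤ) (x : V ⊗[ℂ] LogLaurent) :
    tensorOp 1 (rootPow (-c)) (tensorOp 1 (rootPow c) x) = x := by
  induction x with
  | zero => simp
  | add x y hx hy => rw [map_add, map_add, hx, hy]
  | tmul v f =>
    rw [tensorOp_tmul, tensorOp_tmul, ← mul_assoc (rootPow (-c)), rootPow_mul, neg_add_cancel,
      rootPow_zero, one_mul f, Module.End.one_apply, Module.End.one_apply]

theorem nilpotentPart_logVar_mem (hfin : IsLocallyFinite (A.mode h 0)) {c : ℤ} {Q Q' : Submodule ℂ LogLaurent}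
    (hQ : ∀ f ∈ Q, logVar * f ∈ Q') {x : V ⊗[ℂ] LogLaurent}
    (hx : x ∈ tensorSpan (A.genSpace h r c) Q) :
    tensorOp (nilpotentPart hfin) logVar x ∈ tensorSpan (A.genSpace h r c) Q' :=
  map_mem_of_mem_tensorSpan (fun _ hv f hf => tmul_mem_tensorSpan
    (Module.End.mapsTo_maxGenEigenspace_of_comm
      (nilpotentPart_commute hfin (Commute.refl _)).symm _ hv) (hQ f hf)) hx

theorem positiveModes_mem (hcomm : ∀ m n : ℕ, Commute (A.mode h (m : ℤ)) (A.mode h (n : ℤ))) {c : ℤ} {Q Q' : Submodule ℂ LogLaurent}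
    (hQ : ∀ f ∈ Q, ∀ n : ℕ, rootPow (-((r : ℤ) * ((n : ℤ) + 1))) * f ∈ Q')
    {x : V ⊗[ℂ] LogLaurent} (hx : x ∈ tensorSpan (A.genSpace h r c) Q) :
    A.positiveModes r h x ∈ tensorSpan (A.genSpace h r c) Q' :=
  map_mem_of_mem_tensorSpan (fun _ hv f hf => A.modeSum_tmul_mem _
    (fun n => Module.End.mapsTo_maxGenEigenspace_of_comm (by exact_mod_cast hcomm 0 n) _ hv)
    (hQ f hf)) hx

/-! ### The differential equation of `Δ(h, z)` -/

/-- The operator `exp(N log z) exp(∑_{n ≥ 1} ((-1)^{n-1} / n) h_n z^{-n})`, with `N` the nilpotent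
part of `h_0`; it is `Δ(h, z)` without the factor `z^S`. -/
def unipotentDelta (r : ℕ) (hh : h ∈ A.weight 1) (hfin : IsLocallyFinite (A.mode h 0)) :
    Module.End ℂ (V ⊗[ℂ] LogLaurent) :=
  expNil (tensorOp (nilpotentPart hfin) logVar) (tensorOp_nilpotentPart_isLocallyNilpotent hfin) *
    expNil (A.positiveModes r h) (A.positiveModes_isLocallyNilpotent r hh)

/-- The operator `∂ - N z⁻¹ - ∑_{n ≥ 1} (-1)^n h_n z^{-n-1}`, that is, `∂` minus the logarithmic
derivative of `unipotentDelta`. -/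
def connection (r : ℕ) (hfin : IsLocallyFinite (A.mode h 0)) :
    Module.End ℂ (V ⊗[ℂ] LogLaurent) :=
  tensorDerivation V r - tensorOp (nilpotentPart hfin) (rootPow (-(r : ℤ))) -
    A.positiveModesDeriv r h

theorem commute_positiveModesDeriv_positiveModes
    (hcomm : ∀ m n : ℕ, Commute (A.mode h (m : ℤ)) (A.mode h (n : ℤ))) :
    Commute (A.positiveModesDeriv r h) (A.positiveModes r h) :=
  A.modeSum_commute_modeSum hcomm _ _ _ _

theorem commute_positiveModesDeriv_nilpotentPart
    (hcomm : ∀ m n : ℕ, Commute (A.mode h (m : ℤ)) (A.mode h (n : ℤ)))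
    (hfin : IsLocallyFinite (A.mode h 0)) :
    Commute (A.positiveModesDeriv r h) (tensorOp (nilpotentPart hfin) logVar) :=
  A.modeSum_commute_tensorOp _ _
    (fun n => (nilpotentPart_commute hfin (by exact_mod_cast hcomm 0 n)).symm) _

theorem tensorDerivation_mul_nilpotentPart (hfin : IsLocallyFinite (A.mode h 0)) :
    tensorDerivation V r * tensorOp (nilpotentPart hfin) logVar =
      tensorOp (nilpotentPart hfin) logVar * tensorDerivation V r +
        tensorOp (nilpotentPart hfin) (rootPow (-(r : ℤ))) := by
  rw [tensorDerivation_mul_tensorOp, logDerivation_logVar]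

theorem tensorDerivation_mul_positiveModes :
    tensorDerivation V r * A.positiveModes r h =
      A.positiveModes r h * tensorDerivation V r + A.positiveModesDeriv r h :=
  A.tensorDerivation_mul_modeSum r h _ _

/-- `unipotentDelta` is a gauge transformation from `∂` to `connection`. -/
theorem connection_mul_unipotentDelta (hh : h ∈ A.weight 1)
    (hcomm : ∀ m n : ℕ, Commute (A.mode h (m : ℤ)) (A.mode h (n : ℤ)))
    (hfin : IsLocallyFinite (A.mode h 0)) :
    A.connection r hfin * A.unipotentDelta r hh hfin =
      A.unipotentDelta r hh hfin * tensorDerivation V r := by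
  exact sub_sub_mul_expNil_mul_expNil _ _ (A.tensorDerivation_mul_nilpotentPart hfin)
    A.tensorDerivation_mul_positiveModes (tensorOp_commute (Commute.refl _) _ _)
    (A.commute_positiveModesDeriv_nilpotentPart hcomm hfin)
    (A.commute_positiveModesDeriv_positiveModes hcomm)

/-- A horizontal section without leading term vanishes. -/
theorem eq_zero_of_connection_eq_zero (hr : 0 < r) (hh : h ∈ A.weight 1)
    (hcomm : ∀ m n : ℕ, Commute (A.mode h (m : ℤ)) (A.mode h (n : ℤ)))
    (hfin : IsLocallyFinite (A.mode h 0)) {c : ℤ} {x : V ⊗[ℂ] LogLaurent}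
    (hx : x ∈ tensorSpan (A.genSpace h r c) (expLT 0)) (h0 : A.connection r hfin x = 0) :
    x = 0 := by
  have hN := tensorOp_nilpotentPart_isLocallyNilpotent hfin
  have hP := A.positiveModes_isLocallyNilpotent r hh
  -- the inverse gauge transformation turns the connection into `∂`
  have key := expNil_neg_mul_expNil_neg_mul_sub_sub hN hP
    (A.tensorDerivation_mul_nilpotentPart (r := r) hfin)
    A.tensorDerivation_mul_positiveModes (tensorOp_commute (Commute.refl _) _ _)
    (A.commute_positiveModesDeriv_nilpotentPart hcomm hfin)
    (A.commute_positiveModesDeriv_positiveModes hcomm)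
  have hzero : expNil _ hP.neg (expNil _ hN.neg (A.connection r hfin x)) =
      tensorDerivation V r (expNil _ hP.neg (expNil _ hN.neg x)) := LinearMap.congr_fun key x
  rw [h0, map_zero, map_zero] at hzero
  have hlog : ∀ f ∈ expLT 0, logVar * f ∈ expLT 0 := fun f hf => by
    simpa using mul_mem_expLT (expLT_le_expLE 0 logVar_mem_expLT) hf
  have hpow : ∀ f ∈ expLT 0, ∀ n : ℕ, rootPow (-((r : ℤ) * ((n : ℤ) + 1))) * f ∈ expLT 0 :=
    fun f hf n => by
      simpa using mul_mem_expLT (expLT_le_expLE 0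
        (rootPow_mem_expLT (neg_lt_zero.2 (by positivity)))) hf
  have hmem := expNil_mem hP.neg (fun v hv => neg_mem (A.positiveModes_mem hcomm hpow hv))
    (expNil_mem hN.neg (fun v hv => neg_mem (A.nilpotentPart_logVar_mem hfin hlog hv)) hx)
  have := eq_zero_of_tensorDerivation_eq_zero hr
    (Submodule.map₂_le_map₂_left le_top hmem) hzero.symm
  exact expNil_injective hN.neg (expNil_injective hP.neg (by rw [this, map_zero, map_zero]))

/-- On the generalized eigenspace of eigenvalue `c / r`, the factor `z^{c/r}` turns `connection`
into `∂ - (h ⊗ z⁻¹)_0`. -/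
theorem tensorDerivation_sub_tensorModeₗ (hr : 0 < r) (hfin : IsLocallyFinite (A.mode h 0)) {c : ℤ}
    {Q : Submodule ℂ LogLaurent} {x : V ⊗[ℂ] LogLaurent}
    (hx : x ∈ tensorSpan (A.genSpace h r c) Q) :
    tensorDerivation V r (tensorOp 1 (rootPow c) x) -
        A.tensorModeₗ (logDerivation r) 0 (h ⊗ₜ rootPow (-(r : ℤ))) (tensorOp 1 (rootPow c) x) =
      tensorOp 1 (rootPow c) (A.connection r hfin x) := by
  have h₁ := LinearMap.congr_fun
    (tensorDerivation_mul_tensorOp r (1 : Module.End ℂ V) (rootPow c)) x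
  have h₂ := LinearMap.congr_fun (A.modeSum_commute_tensorOp (h := h)
    (fun n => (-1 : ℂ) ^ n / ((n : ℂ) + 1))
    (fun n => logDerivation r (rootPow (-((r : ℤ) * ((n : ℤ) + 1)))))
    (fun n => Commute.one_right _) (rootPow c)).eq x
  have h₃ : tensorOp (1 : Module.End ℂ V) (logDerivation r (rootPow c)) x -
      tensorOp (A.mode h 0) (rootPow (-(r : ℤ))) (tensorOp 1 (rootPow c) x) =
      -tensorOp 1 (rootPow c) (tensorOp (nilpotentPart hfin) (rootPow (-(r : ℤ))) x) := by
    refine map_eq_of_mem_tensorSpan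
      (L := tensorOp (1 : Module.End ℂ V) (logDerivation r (rootPow c)) -
        tensorOp (A.mode h 0) (rootPow (-(r : ℤ))) * tensorOp 1 (rootPow c))
      (L' := -(tensorOp 1 (rootPow c) * tensorOp (nilpotentPart hfin) (rootPow (-(r : ℤ)))))
      (fun v hv f _ => ?_) hx
    have hv' : nilpotentPart hfin v = A.mode h 0 v - ((c : ℂ) / r) • v := by
      rw [nilpotentPart, LinearMap.sub_apply, semisimplePart_of_mem hfin hv]
    simp only [LinearMap.sub_apply, LinearMap.neg_apply, Module.End.mul_apply, tensorOp_tmul,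
      Module.End.one_apply]
    rw [hv', logDerivation_rootPow, ← mul_assoc (rootPow (-(r : ℤ))),
      ← mul_assoc (rootPow c), rootPow_mul, rootPow_mul, neg_add_eq_sub, ← sub_eq_add_neg,
      TensorProduct.sub_tmul, smul_mul_assoc, TensorProduct.tmul_smul, TensorProduct.smul_tmul']
    abel
  simp only [Module.End.mul_apply, LinearMap.add_apply] at h₁ h₂
  change A.positiveModesDeriv r h _ = tensorOp 1 _ (A.positiveModesDeriv r h x) at h₂
  rw [h₁, A.tensorModeₗ_zero_eq hr, LinearMap.add_apply, h₂, connection, LinearMap.sub_apply,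
    LinearMap.sub_apply, map_sub, map_sub, sub_eq_add_neg (tensorOp 1 (rootPow c) _), ← h₃]
  abel

theorem unipotentDelta_sub_mem (hh : h ∈ A.weight 1) (hr : 0 < r)
    (hcomm : ∀ m n : ℕ, Commute (A.mode h (m : ℤ)) (A.mode h (n : ℤ)))
    (hfin : IsLocallyFinite (A.mode h 0)) {c : ℤ} {u : V} (hu : u ∈ A.genSpace h r c) :
    A.unipotentDelta r hh hfin (u ⊗ₜ 1) - u ⊗ₜ 1 ∈ tensorSpan (A.genSpace h r c) (expLT 0) := by
  have hle : tensorSpan (A.genSpace h r c) (expLT 0) ≤ tensorSpan (A.genSpace h r c) (expLE 0) :=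
    Submodule.map₂_le_map₂_right (expLT_le_expLE 0)
  have hlog : ∀ f ∈ expLE 0, logVar * f ∈ expLT 0 := fun f hf => by
    simpa using mul_mem_expLT' logVar_mem_expLT hf
  have hpow : ∀ f ∈ expLE 0, ∀ n : ℕ, rootPow (-((r : ℤ) * ((n : ℤ) + 1))) * f ∈ expLT 0 :=
    fun f hf n => by
      simpa using mul_mem_expLT' (rootPow_mem_expLT (neg_lt_zero.2 (by positivity))) hf
  have hu1 : u ⊗ₜ[ℂ] (1 : LogLaurent) ∈ tensorSpan (A.genSpace h r c) (expLE 0) :=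
    tmul_mem_tensorSpan hu (by rw [← rootPow_zero]; exact rootPow_mem_expLE 0)
  have h₁ := expNil_sub_mem (A.positiveModes_isLocallyNilpotent r hh) hle
    (fun v hv => A.positiveModes_mem hcomm hpow hv) hu1
  have h₂ := expNil_sub_mem (tensorOp_nilpotentPart_isLocallyNilpotent hfin) hle
    (fun v hv => A.nilpotentPart_logVar_mem hfin hlog hv) (add_mem (hle h₁) hu1)
  rw [sub_add_cancel] at h₂
  have := add_mem h₂ h₁
  rwa [sub_add_sub_cancel] at this

theorem Delta_eq (hh : h ∈ A.weight 1) (hr : 0 < r)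
    (hcomm : ∀ m n : ℕ, Commute (A.mode h (m : ℤ)) (A.mode h (n : ℤ)))
    (hfin : IsLocallyFinite (A.mode h 0)) {c : ℤ} {u : V} (hu : u ∈ A.genSpace h r c) :
    A.Delta hr hh hfin u = tensorOp 1 (rootPow c) (A.unipotentDelta r hh hfin (u ⊗ₜ 1)) := by
  have hmem := add_mem (Submodule.map₂_le_map₂_right le_top
    (A.unipotentDelta_sub_mem hh hr hcomm hfin hu)) (tmul_mem_tensorSpan hu
      (Submodule.mem_top (x := (1 : LogLaurent))))
  rw [sub_add_cancel] at hmem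
  exact zPowSemisimple_of_mem hr hfin hmem

/-- The leading term of `Δ(h, z) u` is `z^{c/r} u`. -/
theorem Delta_sub_mem (hh : h ∈ A.weight 1) (hr : 0 < r)
    (hcomm : ∀ m n : ℕ, Commute (A.mode h (m : ℤ)) (A.mode h (n : ℤ)))
    (hfin : IsLocallyFinite (A.mode h 0)) {c : ℤ} {u : V} (hu : u ∈ A.genSpace h r c) :
    A.Delta hr hh hfin u - u ⊗ₜ rootPow c ∈ tensorSpan (A.genSpace h r c) (expLT c) := by
  have h0 : u ⊗ₜ[ℂ] rootPow c = tensorOp 1 (rootPow c) (u ⊗ₜ 1) := by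
    rw [tensorOp_tmul, mul_one (rootPow c), Module.End.one_apply]
  rw [A.Delta_eq hh hr hcomm hfin hu, h0, ← map_sub]
  refine map_mem_of_mem_tensorSpan (fun v hv f hf => ?_)
    (A.unipotentDelta_sub_mem hh hr hcomm hfin hu)
  have := mul_mem_expLT (rootPow_mem_expLE c) hf
  rw [add_zero] at this
  exact tmul_mem_tensorSpan hv this

/-- `Δ(h, z) u` is a solution of `∂ x = (h ⊗ z⁻¹)_0 x`. -/
theorem tensorDerivation_Delta (hh : h ∈ A.weight 1) (hr : 0 < r)
    (hcomm : ∀ m n : ℕ, Commute (A.mode h (m : ℤ)) (A.mode h (n : ℤ)))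
    (hfin : IsLocallyFinite (A.mode h 0)) {c : ℤ} {u : V} (hu : u ∈ A.genSpace h r c) :
    tensorDerivation V r (A.Delta hr hh hfin u) =
      A.tensorModeₗ (logDerivation r) 0 (h ⊗ₜ rootPow (-(r : ℤ))) (A.Delta hr hh hfin u) := by
  have hmem := add_mem (Submodule.map₂_le_map₂_right le_top
    (A.unipotentDelta_sub_mem hh hr hcomm hfin hu)) (tmul_mem_tensorSpan hu
      (Submodule.mem_top (x := (1 : LogLaurent))))
  rw [sub_add_cancel] at hmem
  rw [A.Delta_eq hh hr hcomm hfin hu, ← sub_eq_zero,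
    A.tensorDerivation_sub_tensorModeₗ hr hfin hmem, ← Module.End.mul_apply (A.connection r hfin),
    A.connection_mul_unipotentDelta hh hcomm hfin, Module.End.mul_apply, tensorDerivation_tmul,
    Derivation.map_one_eq_zero, TensorProduct.tmul_zero, map_zero, map_zero]

/-- A solution of `∂ x = (h ⊗ z⁻¹)_0 x` is determined by its leading term. -/
theorem eq_zero_of_tensorDerivation_eq (hh : h ∈ A.weight 1) (hr : 0 < r)
    (hcomm : ∀ m n : ℕ, Commute (A.mode h (m : ℤ)) (A.mode h (n : ℤ)))
    (hfin : IsLocallyFinite (A.mode h 0)) {c : ℤ} {x : V ⊗[ℂ] LogLaurent}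
    (hx : x ∈ tensorSpan (A.genSpace h r c) (expLT c))
    (h0 : tensorDerivation V r x =
      A.tensorModeₗ (logDerivation r) 0 (h ⊗ₜ rootPow (-(r : ℤ))) x) : x = 0 := by
  have hy : tensorOp 1 (rootPow (-c)) x ∈ tensorSpan (A.genSpace h r c) (expLT 0) := by
    refine map_mem_of_mem_tensorSpan (fun v hv f hf => ?_) hx
    have := mul_mem_expLT (rootPow_mem_expLE (-c)) hf
    rw [neg_add_cancel] at this
    exact tmul_mem_tensorSpan hv this
  have hxy : tensorOp 1 (rootPow c) (tensorOp 1 (rootPow (-c)) x) = x := by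
    have := tensorOp_rootPow_neg (-c) x
    rwa [neg_neg] at this
  have h₁ := A.tensorDerivation_sub_tensorModeₗ hr hfin hy
  rw [hxy, h0, sub_self] at h₁
  have h₂ := congrArg (tensorOp 1 (rootPow (-c))) h₁
  rw [map_zero, tensorOp_rootPow_neg] at h₂
  rw [← hxy, A.eq_zero_of_connection_eq_zero hr hh hcomm hfin hy h₂.symm, map_zero]

/-- Two solutions of `∂ x = (h ⊗ z⁻¹)_0 x` with the same leading term agree. -/
theorem eq_of_tensorDerivation_eq (hh : h ∈ A.weight 1) (hr : 0 < r)
    (hcomm : ∀ m n : ℕ, Commute (A.mode h (m : ℤ)) (A.mode h (n : ℤ)))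
    (hfin : IsLocallyFinite (A.mode h 0)) {c : ℤ} {t x y : V ⊗[ℂ] LogLaurent}
    (hxt : x - t ∈ tensorSpan (A.genSpace h r c) (expLT c))
    (hyt : y - t ∈ tensorSpan (A.genSpace h r c) (expLT c))
    (hx : tensorDerivation V r x =
      A.tensorModeₗ (logDerivation r) 0 (h ⊗ₜ rootPow (-(r : ℤ))) x)
    (hy : tensorDerivation V r y =
      A.tensorModeₗ (logDerivation r) 0 (h ⊗ₜ rootPow (-(r : ℤ))) y) : x = y := by
  have hxy := sub_mem hxt hyt
  rw [sub_sub_sub_cancel_right] at hxy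
  exact sub_eq_zero.1 (A.eq_zero_of_tensorDerivation_eq hh hr hcomm hfin hxy
    (by rw [map_sub, map_sub, hx, hy]))

/-- Products of elements with leading terms `z^{a/r} u` and `z^{b/r} w`. -/
theorem tensorModeₗ_sub_mem (hr : 0 < r) {a b : ℤ} {u w : V} {x y : V ⊗[ℂ] LogLaurent}
    (hu : u ∈ A.genSpace h r a) (hw : w ∈ A.genSpace h r b)
    (hx : x - u ⊗ₜ rootPow a ∈ tensorSpan (A.genSpace h r a) (expLT a))
    (hy : y - w ⊗ₜ rootPow b ∈ tensorSpan (A.genSpace h r b) (expLT b)) (n : ℤ) :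
    A.tensorModeₗ (R := LogLaurent) (logDerivation r) n x y - A.mode u n w ⊗ₜ rootPow (a + b) ∈
      tensorSpan (A.genSpace h r (a + b)) (expLT (a + b)) := by
  have hlu := tmul_mem_tensorSpan hu (rootPow_mem_expLE a)
  have hlw := tmul_mem_tensorSpan hw (rootPow_mem_expLE b)
  have hy' := add_mem (Submodule.map₂_le_map₂_right (expLT_le_expLE b) hy) hlw
  rw [sub_add_cancel] at hy'
  have h₁ := A.tensorModeₗ_mem_left hr hx hy' n
  have h₂ := A.tensorModeₗ_mem_right hr hlu hy n
  have h₃ := A.tensorModeₗ_tmul_sub_mem hr (rootPow_mem_expLE a) (rootPow_mem_expLE b) (n := n)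
    (A.mode_mem_genSpace hu hw)
  rw [rootPow_mul] at h₃
  rw [map_sub, LinearMap.sub_apply] at h₁
  rw [map_sub] at h₂
  have := add_mem (add_mem h₁ h₂) h₃
  rwa [sub_add_sub_cancel, sub_add_sub_cancel] at this

/-- The solutions of `∂ x = (h ⊗ z⁻¹)_0 x` are closed under all products, as `∂` and
`(h ⊗ z⁻¹)_0` are derivations. -/
theorem tensorDerivation_tensorModeₗ {x y : V ⊗[ℂ] LogLaurent}
    (hx : tensorDerivation V r x =
      A.tensorModeₗ (logDerivation r) 0 (h ⊗ₜ rootPow (-(r : ℤ))) x)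
    (hy : tensorDerivation V r y =
      A.tensorModeₗ (logDerivation r) 0 (h ⊗ₜ rootPow (-(r : ℤ))) y) (n : ℤ) :
    tensorDerivation V r (A.tensorModeₗ (R := LogLaurent) (logDerivation r) n x y) =
      A.tensorModeₗ (logDerivation r) 0 (h ⊗ₜ rootPow (-(r : ℤ)))
        (A.tensorModeₗ (R := LogLaurent) (logDerivation r) n x y) := by
  rw [A.tensorModeₗ_zero_tensorModeₗ, ← hx, ← hy, tensorDerivation_apply, tensorDerivation_apply,
    tensorDerivation_apply, A.lTensor_tensorModeₗ (R := LogLaurent)]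

theorem Delta_mode_of_mem (hh : h ∈ A.weight 1) (hr : 0 < r)
    (hcomm : ∀ m n : ℕ, Commute (A.mode h (m : ℤ)) (A.mode h (n : ℤ)))
    (hfin : IsLocallyFinite (A.mode h 0)) {a b : ℤ} {u w : V} (hu : u ∈ A.genSpace h r a)
    (hw : w ∈ A.genSpace h r b) (n : ℤ) :
    A.Delta hr hh hfin (A.mode u n w) = A.tensorModeₗ (R := LogLaurent) (logDerivation r) n
      (A.Delta hr hh hfin u) (A.Delta hr hh hfin w) := by
  have huw := A.mode_mem_genSpace hu hw n
  exact A.eq_of_tensorDerivation_eq hh hr hcomm hfin (A.Delta_sub_mem hh hr hcomm hfin huw)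
    (A.tensorModeₗ_sub_mem hr hu hw (A.Delta_sub_mem hh hr hcomm hfin hu)
      (A.Delta_sub_mem hh hr hcomm hfin hw) n)
    (A.tensorDerivation_Delta hh hr hcomm hfin huw)
    (A.tensorDerivation_tensorModeₗ (A.tensorDerivation_Delta hh hr hcomm hfin hu)
      (A.tensorDerivation_Delta hh hr hcomm hfin hw) n)

theorem Delta_vacuum (hh : h ∈ A.weight 1) (hr : 0 < r)
    (hfin : IsLocallyFinite (A.mode h 0)) :
    A.Delta hr hh hfin A.vacuum = A.vacuum ⊗ₜ 1 := by
  have h0 : ∀ n : ℕ, A.mode h (n : ℤ) A.vacuum = 0 := A.creation_regular h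
  have hvac : A.vacuum ∈ A.genSpace h r 0 := by
    refine (Module.End.mem_maxGenEigenspace _ _ _).2 ⟨1, ?_⟩
    have := h0 0
    rw [Nat.cast_zero] at this
    simp [this]
  have hN : nilpotentPart hfin A.vacuum = 0 := by
    rw [nilpotentPart, LinearMap.sub_apply, semisimplePart_of_mem hfin hvac]
    have := h0 0
    rw [Nat.cast_zero] at this
    simp [this]
  change zPowSemisimple hr hfin (expNil _ _ (expNil _ _ (A.vacuum ⊗ₜ[ℂ] (1 : LogLaurent)))) = _
  rw [expNil_of_apply_eq_zero (A.positiveModes_isLocallyNilpotent r hh),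
    expNil_of_apply_eq_zero (tensorOp_nilpotentPart_isLocallyNilpotent hfin),
    zPowSemisimple_tmul hr hfin (semisimplePart_of_mem hfin hvac), rootPow_zero,
    mul_one (1 : LogLaurent)]
  · rw [tensorOp_tmul, hN, TensorProduct.zero_tmul]
  · rw [A.positiveModes_eq, A.modeSum_tmul]
    refine finsum_eq_zero_of_forall_eq_zero fun n => ?_
    have := h0 (n + 1)
    rw [Nat.cast_succ] at this
    rw [this, TensorProduct.zero_tmul, smul_zero]

end VertexOperatorAlgebra
end

theorem corollary3p20 {V : Type*} [AddCommGroup V] [Module ℂ V] (A : VertexOperatorAlgebra V)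
    (r : ℕ) (hr : 0 < r) (h : V) (hh : h ∈ A.weight 1)
    (hcomm : ∀ m n : ℕ, ⁅A.mode h (m : ℤ), A.mode h (n : ℤ)⁆ = 0)
    (hfin : IsLocallyFinite (A.mode h 0))
    (heig : ∀ μ : ℂ, Module.End.HasEigenvalue (A.mode h 0) μ → ∃ k : ℤ, μ = (k : ℂ) / (r : ℂ)) :
    A.IsPseudoEndomorphism (R := LogLaurent) (logDerivation r) (A.Delta hr hh hfin) := by
  have hcomm' : ∀ m n : ℕ, Commute (A.mode h (m : ℤ)) (A.mode h (n : ℤ)) := fun m n =>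
    commute_iff_lie_eq.2 (hcomm m n)
  refine ⟨A.Delta_vacuum hh hr hfin, fun v w n => ?_⟩
  have htop := hfin.iSup_div_eq_top heig
  rw [← A.tensorModeₗ_apply]
  refine Submodule.iSup_induction (fun k : ℤ => A.genSpace h r k)
    (motive := fun v => A.Delta hr hh hfin (A.mode v n w) = A.tensorModeₗ (R := LogLaurent) (logDerivation r) n
      (A.Delta hr hh hfin v) (A.Delta hr hh hfin w))
    (htop ▸ Submodule.mem_top : v ∈ ⨆ k : ℤ, A.genSpace h r k) (fun a u hu => ?_) ?_ ?_
  · refine Submodule.iSup_induction (fun k : ℤ => A.genSpace h r k)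
      (motive := fun w => A.Delta hr hh hfin (A.mode u n w) = A.tensorModeₗ (R := LogLaurent) (logDerivation r) n
        (A.Delta hr hh hfin u) (A.Delta hr hh hfin w))
      (htop ▸ Submodule.mem_top : w ∈ ⨆ k : ℤ, A.genSpace h r k)
      (fun b w hw => A.Delta_mode_of_mem hh hr hcomm' hfin hu hw n) ?_ ?_
    · simp only [map_zero]
    · intro x y hx hy
      simp only [map_add, hx, hy]
  · simp only [← A.modeₗ_apply, map_zero, LinearMap.zero_apply]
  · intro x y hx hy
    rw [← A.modeₗ_apply] at hx hy ⊢
    simp only [map_add, LinearMap.add_apply, hx, hy]
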